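/- Let $(\Lambda_{i,j})_{i,j\ge 1}$ be a nonnegative symmetric coagulation kernel, $0\le\Lambda_{i,j}=\Lambda_{j,i}$, of the form $$\Lambda_{i,j}=\theta_i\theta_j+\kappa_{i,j},\qquad i,j\ge 1,$$ with nonnegative real numbers $\theta_i$ and $\kappa_{i,j}$ such that $$\inf_{i\ge 1}\frac{\theta_i}{i}=B>0\quad\text{and}\quad \kappa_{i,j}\le A\,\theta_i\theta_j\ \text{ for all } i,j\ge 1,$$ for some constant $A\ge 0$. For $p\ge 0$ and a real sequence $y=(y_i)_{i\ge1}$ put $\|y\|_p=\sum_{i=1}^\infty i^p|y_i|\in[0,\infty]$, and let $Y_p^+$ be the set of sequences $y$ with $\|y\|_p<\infty$ and $y_i\ge 0$ for all $i\ge1$. Consider the discrete Safronov--Dubovskii coagulation equations $$\frac{d\omega_i}{dt}=\omega_{i-1}\sum_{j=1}^{i-1}j\Lambda_{i-1,j}\omega_j-\omega_i\sum_{j=1}^{i}j\Lambda_{i,j}\omega_j-\sum_{j=i}^{\infty}\Lambda_{i,j}\omega_i\omega_j,\qquad \omega_i(0)=\omega_i^{in},\qquad i\ge 1,$$ where the first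 term is $0$ for $i=1$. A solution on $[0,\infty)$ is a sequence $\omega=(\omega_i)_{i\ge1}$ of nonnegative continuous functions on $[0,\infty)$ such that, for all $i\ge1$ and $t>0$, $\sum_{j=1}^\infty\Lambda_{i,j}\omega_j\in L^1(0,t)$ and $$\omega_i(t)=\omega_i^{in}+\int_0^t\Big(\omega_{i-1}(s)\sum_{j=1}^{i-1}j\Lambda_{i-1,j}\omega_j(s)-\omega_i(s)\sum_{j=1}^{i}j\Lambda_{i,j}\omega_j(s)-\sum_{j=i}^{\infty}\Lambda_{i,j}\omega_i(s)\omega_j(s)\Big)ds.$$ Then for every $\omega^{in}=(\omega_i^{in})_{i\ge1}\in Y_0^+$ there exists at least one solution $\omega$ on $[0,\infty)$ such that $\omega(t)\in Y_0^+$ for every $t\ge0$ and $\|\omega(t)\|_1<\infty$ for every $t>0$. -/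

import Mathlib

open MeasureTheory
open scoped ENNReal

namespace SafronovDubovskii

noncomputable section

/-- The weighted norm `‖y‖_p = ∑_{i ≥ 1} i ^ p |y_i|` of a real sequence `(y_i)_{i ≥ 1}`, as an
element of `[0, ∞]`; it is infinite exactly when the series diverges. -/
def normY (p : ℝ) (y : ℕ+ → ℝ) : ℝ≥0∞ :=
  ∑' i : ℕ+, ENNReal.ofReal (((i : ℕ) : ℝ) ^ p * |y i|)

/-- The space `Y_p` of sequences `(y_i)_{i ≥ 1}` with `∑ i ^ p |y_i| < ∞`. -/
def Y (p : ℝ) : Set (ℕ+ → ℝ) := {y | normY p y < ∞}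

/-- The nonnegative cone `Y_p^+` of `Y_p`. -/
def YPos (p : ℝ) : Set (ℕ+ → ℝ) := {y | y ∈ Y p ∧ ∀ i, 0 ≤ y i}

/-- A coagulation kernel: a nonnegative symmetric function of two cluster sizes. -/
def IsCoagulationKernel (K : ℕ+ → ℕ+ → ℝ) : Prop :=
  (∀ i j, 0 ≤ K i j) ∧ ∀ i j, K i j = K j i

/-- The kernel splits as `K i j = θ i * θ j + κ i j` with nonnegative `θ` and `κ`. -/
def CoagRate (K : ℕ+ → ℕ+ → ℝ) (θ : ℕ+ → ℝ) (κ : ℕ+ → ℕ+ → ℝ) : Prop :=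
  (∀ i, 0 ≤ θ i) ∧ (∀ i j, 0 ≤ κ i j) ∧ ∀ i j, K i j = θ i * θ j + κ i j

/-- At least linear growth of `θ`, namely `inf_{i ≥ 1} θ i / i = B > 0`, together with the bound
`κ i j ≤ A * θ i * θ j` for some `A ≥ 0`. -/
def CoagRateLinear (θ : ℕ+ → ℝ) (κ : ℕ+ → ℕ+ → ℝ) (A B : ℝ) : Prop :=
  0 < B ∧ IsGLB (Set.range fun i : ℕ+ => θ i / ((i : ℕ) : ℝ)) B ∧
    0 ≤ A ∧ ∀ i j, κ i j ≤ A * θ i * θ j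

/-- The right-hand side of the `i`-th discrete Safronov-Dubovskii equation at the state `y`:
`y_{i-1} ∑_{j=1}^{i-1} j K_{i-1,j} y_j - y_i ∑_{j=1}^{i} j K_{i,j} y_j - ∑_{j=i}^∞ K_{i,j} y_i y_j`.
For `i = 1` the first sum is empty, so the first term vanishes whatever `i - 1` means. -/
def rhs (K : ℕ+ → ℕ+ → ℝ) (y : ℕ+ → ℝ) (i : ℕ+) : ℝ :=
  y (i - 1) * ∑ j ∈ Finset.Ico 1 i, ((j : ℕ) : ℝ) * K (i - 1) j * y j
    - y i * ∑ j ∈ Finset.Icc 1 i, ((j : ℕ) : ℝ) * K i j * y j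
    - ∑' j : Set.Ici i, K i j * y i * y j

/-- `ω = (ω_i)_{i ≥ 1}` is a solution on `[0, T)`, `T ∈ (0, ∞]`, with initial datum `ω₀`: each
`ω_i` is nonnegative and continuous on `[0, T)`, each `∑_j K_{i,j} ω_j` is an `L¹(0, t)` function
for `t < T` (the series converges almost everywhere and its sum is integrable), and the
time-integrated equations hold; at `t = 0` they read `ω_i(0) = (ω₀)_i`.
Values of `ω` outside `[0, T)` play no role. -/
structure IsSolution (K : ℕ+ → ℕ+ → ℝ) (ω₀ : ℕ+ → ℝ) (T : EReal) (ω : ℕ+ → ℝ → ℝ) : Prop where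
  nonneg : ∀ i, ∀ t : ℝ, 0 ≤ t → (t : EReal) < T → 0 ≤ ω i t
  continuousOn : ∀ i, ContinuousOn (ω i) {t : ℝ | 0 ≤ t ∧ (t : EReal) < T}
  summable : ∀ i, ∀ t : ℝ, 0 ≤ t → (t : EReal) < T →
    ∀ᵐ s ∂(volume.restrict (Set.Ioo 0 t)), Summable fun j => K i j * ω j s
  integrable : ∀ i, ∀ t : ℝ, 0 ≤ t → (t : EReal) < T →
    IntegrableOn (fun s => ∑' j, K i j * ω j s) (Set.Ioo 0 t) volume
  integral_eq : ∀ i, ∀ t : ℝ, 0 ≤ t → (t : EReal) < T →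
    ω i t = ω₀ i + ∫ s in (0 : ℝ)..t, rhs K (fun j => ω j s) i

end

end SafronovDubovskii

namespace SafronovDubovskii
open Filter Topology

/-! Everything rests on one dissipation inequality, obtained by testing the system against the
weight `min i m`. For `j ≤ i` the product `L i j * x i * x j` is multiplied by `j * (min (i + 1) m -
min i m)` from the flux and by `-min j m` from the loss. These cancel when `i < m`; when `i ≥ m`
only the loss survives. Since `θ i * θ j ≤ L i j`, the weighted sum decreases at rate at least `m /
2` times the square of the `θ`-moment over sizes `≥ m` (`sum_min_mul_truncField_le`).

Three consequences hold uniformly in the truncation. Dividing by `m`, the squared `L²`-in-time norm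
of the `θ`-tail is at most `2 * ∑ min i m / m * x₀ i`, which tends to zero for merely summable data
(`tendsto_tsum_min_div`, `exists_tail_le`); hence the infinite loss sum passes to the limit however
fast `θ` grows. With `m = 1`, the `L²` bound on the full `θ`-moment makes the fields equi-integrable
(`exists_modulus`), which gives compactness (`exists_subseq_tendsto`). Finally, `θ i ≥ B * i` and
the monotonicity of the first moment turn the same bound into a first moment of order `t ^ (-1/2)`,
finite for `t > 0`.

The approximations are explicit Euler schemes for the truncated systems. The tested functionals are
linear in the state, so the scheme inherits the dissipation without error. -/

/-- Kernels on `ℕ` comparable to `θ i * θ j` with `θ` of at least linear growth. -/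
structure ProductBounds (L : ℕ → ℕ → ℝ) (θ : ℕ → ℝ) (C B : ℝ) : Prop where
  symm : ∀ i j, L i j = L j i
  theta_nonneg : ∀ i, 0 ≤ θ i
  le_kernel : ∀ i j, θ i * θ j ≤ L i j
  kernel_le : ∀ i j, L i j ≤ C * (θ i * θ j)
  C_nonneg : 0 ≤ C
  B_pos : 0 < B
  linear : ∀ i : ℕ, B * i ≤ θ i

theorem ProductBounds.nonneg {L : ℕ → ℕ → ℝ} {θ : ℕ → ℝ} {C B : ℝ} (H : ProductBounds L θ C B)
    (i j : ℕ) : 0 ≤ L i j :=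
  (mul_nonneg (H.theta_nonneg i) (H.theta_nonneg j)).trans (H.le_kernel i j)

/-! ### The truncated system and its dissipation -/

/-- The number flux from size `i` to size `i + 1`. -/
def flux (L : ℕ → ℕ → ℝ) (x : ℕ → ℝ) (i : ℕ) : ℝ :=
  x i * ∑ j ∈ Finset.range (i + 1), (j : ℝ) * L i j * x j

/-- The vector field of the Safronov-Dubovskii system truncated to sizes `1, …, n`. -/
def truncField (L : ℕ → ℕ → ℝ) (n : ℕ) (x : ℕ → ℝ) : ℕ → ℝ
  | 0 => 0
  | i + 1 => if i + 1 ≤ n then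
      flux L x i - flux L x (i + 1) - ∑ j ∈ Finset.Icc (i + 1) n, L (i + 1) j * x (i + 1) * x j
    else 0

/-- Nonnegative states supported in `{1, …, n}`. -/
structure IsState (n : ℕ) (x : ℕ → ℝ) : Prop where
  nonneg : ∀ i, 0 ≤ x i
  zero : x 0 = 0
  eq_zero : ∀ i, n < i → x i = 0

theorem flux_nonneg {L : ℕ → ℕ → ℝ} {x : ℕ → ℝ} (hL : ∀ i j, 0 ≤ L i j) (hx : ∀ i, 0 ≤ x i)
    (i : ℕ) : 0 ≤ flux L x i :=
  mul_nonneg (hx i) (Finset.sum_nonneg fun j _ =>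
    mul_nonneg (mul_nonneg (Nat.cast_nonneg j) (hL i j)) (hx j))

/-- Twice the triangular sum is the full square plus the diagonal `∑ y i ^ 2`, whatever the signs.
This is the source of the factor `1 / 2` in the dissipation rate. -/
theorem sq_sum_range_le {y : ℕ → ℝ} (n : ℕ) :
    (∑ i ∈ Finset.range n, y i) ^ 2 ≤
      2 * ∑ i ∈ Finset.range n, ∑ j ∈ Finset.range (i + 1), y i * y j := by
  induction n with
  | zero => simp
  | succ n ih =>
    rw [Finset.sum_range_succ, Finset.sum_range_succ, ← Finset.mul_sum, Finset.sum_range_succ]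
    nlinarith [sq_nonneg (y n)]

theorem sum_range_sum_Icc (n : ℕ) (f : ℕ → ℕ → ℝ) :
    ∑ j ∈ Finset.range (n + 1), ∑ i ∈ Finset.Icc j n, f j i =
      ∑ i ∈ Finset.range (n + 1), ∑ j ∈ Finset.range (i + 1), f j i :=
  Finset.sum_comm' fun a b => by simp only [Finset.mem_range, Finset.mem_Icc]; omega

/-- The truncated field dissipates `∑ min i m * x i`. -/
theorem sum_min_mul_truncField_le {L : ℕ → ℕ → ℝ} {θ : ℕ → ℝ} {C B : ℝ}
    (H : ProductBounds L θ C B) {n : ℕ} {x : ℕ → ℝ} (hx : IsState n x) (m : ℕ) :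
    ∑ i ∈ Finset.range (n + 1), ((min i m : ℕ) : ℝ) * truncField L n x i ≤
      -((m : ℝ) / 2 * (∑ j ∈ Finset.Icc m n, θ j * x j) ^ 2) := by
  have hL := H.nonneg
  have h1 : ∑ i ∈ Finset.range (n + 1), ((min i m : ℕ) : ℝ) * truncField L n x i =
      ∑ i ∈ Finset.range n, ((min (i + 1) m : ℕ) : ℝ) * flux L x i
      - ∑ i ∈ Finset.range (n + 1), ((min i m : ℕ) : ℝ) * flux L x i
      - ∑ i ∈ Finset.range (n + 1), ∑ j ∈ Finset.Icc i n,
          ((min i m : ℕ) : ℝ) * (L i j * x i * x j) := by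
    rw [Finset.sum_range_succ', Finset.sum_range_succ' (fun i => ((min i m : ℕ) : ℝ) * flux L x i),
      Finset.sum_range_succ' (fun i => ∑ j ∈ Finset.Icc i n, ((min i m : ℕ) : ℝ) * _)]
    simp only [truncField, mul_zero, add_zero, Nat.zero_min, Nat.cast_zero, zero_mul,
      Finset.sum_const_zero, ← Finset.sum_sub_distrib, ← Finset.mul_sum]
    refine Finset.sum_congr rfl fun i hi => ?_
    rw [if_pos (Nat.succ_le_of_lt (Finset.mem_range.mp hi))]
    ring
  -- Adding the nonnegative term `i = n` lets gain and loss of flux run over the same range.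
  have h2 : ∑ i ∈ Finset.range n, ((min (i + 1) m : ℕ) : ℝ) * flux L x i ≤
      ∑ i ∈ Finset.range (n + 1), ((min (i + 1) m : ℕ) : ℝ) * flux L x i := by
    rw [Finset.sum_range_succ]
    exact le_add_of_nonneg_right (mul_nonneg (Nat.cast_nonneg _) (flux_nonneg hL hx.nonneg n))
  -- After the exchange the larger size is the outer index in the loss, as it is in the flux, so the
  -- two can be compared term by term.
  rw [h1, sum_range_sum_Icc]
  have h3 : ∑ j ∈ Finset.Icc m n, θ j * x j =
      ∑ j ∈ Finset.range (n + 1), if m ≤ j then θ j * x j else 0 := by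
    rw [← Finset.sum_filter]
    refine Finset.sum_congr ?_ fun _ _ => rfl
    ext a; simp only [Finset.mem_range, Finset.mem_Icc, Finset.mem_filter]; omega
  have h4 := sq_sum_range_le (y := fun j => if m ≤ j then θ j * x j else 0) (n + 1)
  rw [← h3] at h4
  have h5 : ∑ i ∈ Finset.range (n + 1), ((min (i + 1) m : ℕ) : ℝ) * flux L x i
      - ∑ i ∈ Finset.range (n + 1), ((min i m : ℕ) : ℝ) * flux L x i
      - ∑ i ∈ Finset.range (n + 1), ∑ j ∈ Finset.range (i + 1),
          ((min j m : ℕ) : ℝ) * (L j i * x j * x i) ≤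
      -(m * ∑ i ∈ Finset.range (n + 1), ∑ j ∈ Finset.range (i + 1),
        (if m ≤ i then θ i * x i else 0) * (if m ≤ j then θ j * x j else 0)) := by
    rw [← Finset.sum_sub_distrib, ← Finset.sum_sub_distrib, Finset.mul_sum, ← Finset.sum_neg_distrib]
    refine Finset.sum_le_sum fun i _ => ?_
    rw [flux, Finset.mul_sum, Finset.mul_sum, Finset.mul_sum, Finset.mul_sum,
      ← Finset.sum_sub_distrib, ← Finset.sum_sub_distrib, ← Finset.sum_neg_distrib]
    refine Finset.sum_le_sum fun j hj => ?_
    have hji : j ≤ i := Nat.lt_succ_iff.mp (Finset.mem_range.mp hj)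
    rw [H.symm j i]
    have hxx : 0 ≤ L i j * (x i * x j) := mul_nonneg (hL i j) (mul_nonneg (hx.nonneg i) (hx.nonneg j))
    have hle : θ i * x i * (θ j * x j) ≤ L i j * (x i * x j) := by
      have := mul_le_mul_of_nonneg_right (H.le_kernel i j) (mul_nonneg (hx.nonneg i) (hx.nonneg j))
      linarith
    -- For `i < m` the weight grows by one from `i` to `i + 1` and the gain `j` equals the loss `min
    -- j m`. For `i ≥ m` the weight is constant and the loss is `m` as soon as `j ≥ m`.
    rcases lt_or_ge i m with him | him
    · rw [min_eq_left (by omega : i + 1 ≤ m), min_eq_left him.le, min_eq_left (by omega : j ≤ m),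
        if_neg (by omega)]
      push_cast
      linarith
    · rw [min_eq_right (by omega : m ≤ i + 1), min_eq_right him, if_pos him]
      split_ifs with hmj
      · rw [min_eq_right hmj]
        have := mul_le_mul_of_nonneg_left hle (Nat.cast_nonneg (α := ℝ) m)
        linarith
      · have := mul_nonneg (Nat.cast_nonneg (α := ℝ) (min j m)) hxx
        linarith
  have h6 := mul_le_mul_of_nonneg_left h4 (by positivity : (0 : ℝ) ≤ m / 2)
  linarith

/-! ### The explicit Euler scheme -/

/-- A bound for the loss rates of the truncated system on states bounded by `M`. -/
def rateBound (L : ℕ → ℕ → ℝ) (M : ℝ) (n : ℕ) : ℝ :=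
  ∑ i ∈ Finset.range (n + 1), ∑ j ∈ Finset.range (n + 1), ((j : ℝ) + 1) * L i j * M

theorem rateBound_nonneg {L : ℕ → ℕ → ℝ} {M : ℝ} (hL : ∀ i j, 0 ≤ L i j) (hM : 0 ≤ M) (n : ℕ) :
    0 ≤ rateBound L M n :=
  Finset.sum_nonneg fun i _ => Finset.sum_nonneg fun j _ =>
    mul_nonneg (mul_nonneg (by positivity) (hL i j)) hM

/-- Every negative term in a component is proportional to that component, with a rate at most
`rateBound L M n`. A step `h` with `h * rateBound L M n ≤ 1` therefore removes at most what is
present. -/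
theorem IsState.euler_step {L : ℕ → ℕ → ℝ} (hL : ∀ i j, 0 ≤ L i j) {M h : ℝ}
    {n : ℕ} (hh : 0 ≤ h) (hhn : h * rateBound L M n ≤ 1) {x : ℕ → ℝ} (hx : IsState n x)
    (hxM : ∀ i, x i ≤ M) : IsState n (fun i => x i + h * truncField L n x i) where
  zero := by simp [truncField, hx.zero]
  eq_zero i hi := by
    cases i with
    | zero => simp [truncField, hx.zero]
    | succ i => simp [truncField, hx.eq_zero _ hi, not_le.mpr hi]
  nonneg i := by
    cases i with
    | zero => simp [truncField, hx.zero]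
    | succ i =>
      simp only [truncField]
      split_ifs with hi
      swap
      · simpa using hx.nonneg (i + 1)
      have hM : 0 ≤ M := (hx.nonneg 0).trans (hxM 0)
      have h0 := flux_nonneg hL hx.nonneg i
      have h1 : ∑ j ∈ Finset.range (i + 1 + 1), (j : ℝ) * L (i + 1) j * x j
          + ∑ j ∈ Finset.Icc (i + 1) n, L (i + 1) j * x j ≤ rateBound L M n := by
        have e1 : ∑ j ∈ Finset.range (i + 1 + 1), (j : ℝ) * L (i + 1) j * x j ≤
            ∑ j ∈ Finset.range (n + 1), (j : ℝ) * L (i + 1) j * M := by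
          refine (Finset.sum_le_sum_of_subset_of_nonneg (t := Finset.range (n + 1)) ?_ ?_).trans
            (Finset.sum_le_sum ?_)
          · intro a; simp only [Finset.mem_range]; omega
          · intro j _ _
            exact mul_nonneg (mul_nonneg (Nat.cast_nonneg j) (hL _ j)) (hx.nonneg j)
          · intro j _
            exact mul_le_mul_of_nonneg_left (hxM j) (mul_nonneg (Nat.cast_nonneg j) (hL _ j))
        have e2 : ∑ j ∈ Finset.Icc (i + 1) n, L (i + 1) j * x j ≤
            ∑ j ∈ Finset.range (n + 1), L (i + 1) j * M := by
          refine (Finset.sum_le_sum_of_subset_of_nonneg (t := Finset.range (n + 1)) ?_ ?_).trans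
            (Finset.sum_le_sum ?_)
          · intro a; simp only [Finset.mem_range, Finset.mem_Icc]; omega
          · intro j _ _
            exact mul_nonneg (hL _ j) (hx.nonneg j)
          · intro j _
            exact mul_le_mul_of_nonneg_left (hxM j) (hL _ j)
        refine (add_le_add e1 e2).trans ?_
        rw [← Finset.sum_add_distrib]
        refine le_trans (le_of_eq (Finset.sum_congr rfl fun j _ => ?_))
          (Finset.single_le_sum (f := fun i => ∑ j ∈ Finset.range (n + 1), ((j : ℝ) + 1) * L i j * M)
            (fun i _ => Finset.sum_nonneg fun j _ =>
              mul_nonneg (mul_nonneg (by positivity) (hL i j)) hM)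
            (Finset.mem_range.mpr (Nat.lt_succ_of_le hi)))
        ring
      have h2 : h * (∑ j ∈ Finset.range (i + 1 + 1), (j : ℝ) * L (i + 1) j * x j
          + ∑ j ∈ Finset.Icc (i + 1) n, L (i + 1) j * x j) ≤ 1 :=
        (mul_le_mul_of_nonneg_left h1 hh).trans hhn
      have h3 : ∑ j ∈ Finset.Icc (i + 1) n, L (i + 1) j * x (i + 1) * x j =
          x (i + 1) * ∑ j ∈ Finset.Icc (i + 1) n, L (i + 1) j * x j := by
        rw [Finset.mul_sum]; exact Finset.sum_congr rfl fun j _ => by ring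
      rw [h3, flux.eq_1 L x (i + 1)]
      have h4 := mul_le_mul_of_nonneg_left h2 (hx.nonneg (i + 1))
      have h5 := mul_nonneg hh h0
      linarith

/-- The explicit Euler scheme for the truncated system. -/
def euler (L : ℕ → ℕ → ℝ) (n : ℕ) (h : ℝ) (x₀ : ℕ → ℝ) : ℕ → ℕ → ℝ
  | 0 => fun i => if 1 ≤ i ∧ i ≤ n then x₀ i else 0
  | k + 1 => fun i => euler L n h x₀ k i + h * truncField L n (euler L n h x₀ k) i

theorem IsState.le_sum_min {n : ℕ} {x : ℕ → ℝ} (hx : IsState n x) (i : ℕ) :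
    x i ≤ ∑ i ∈ Finset.range (n + 1), ((min i 1 : ℕ) : ℝ) * x i := by
  have hnn : ∀ j ∈ Finset.range (n + 1), 0 ≤ ((min j 1 : ℕ) : ℝ) * x j := fun j _ =>
    mul_nonneg (Nat.cast_nonneg _) (hx.nonneg j)
  rcases Nat.eq_zero_or_pos i with rfl | hi
  · rw [hx.zero]; exact Finset.sum_nonneg hnn
  rcases lt_or_ge n i with hni | hni
  · rw [hx.eq_zero i hni]; exact Finset.sum_nonneg hnn
  · have := Finset.single_le_sum hnn (Finset.mem_range.mpr (Nat.lt_succ_of_le hni))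
    rwa [min_eq_right hi, Nat.cast_one, one_mul] at this

theorem sum_min_mul_euler_succ_le {L : ℕ → ℕ → ℝ} {θ : ℕ → ℝ} {C B : ℝ}
    (H : ProductBounds L θ C B) {n : ℕ} {h : ℝ} (hh : 0 ≤ h) {x₀ : ℕ → ℝ} (k : ℕ)
    (hx : IsState n (euler L n h x₀ k)) (m : ℕ) :
    ∑ i ∈ Finset.range (n + 1), ((min i m : ℕ) : ℝ) * euler L n h x₀ (k + 1) i
      + h * ((m : ℝ) / 2 * (∑ j ∈ Finset.Icc m n, θ j * euler L n h x₀ k j) ^ 2) ≤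
    ∑ i ∈ Finset.range (n + 1), ((min i m : ℕ) : ℝ) * euler L n h x₀ k i := by
  have h1 := mul_le_mul_of_nonneg_left (sum_min_mul_truncField_le H hx m) hh
  have h2 : ∑ i ∈ Finset.range (n + 1), ((min i m : ℕ) : ℝ) * euler L n h x₀ (k + 1) i =
      ∑ i ∈ Finset.range (n + 1), ((min i m : ℕ) : ℝ) * euler L n h x₀ k i +
      h * ∑ i ∈ Finset.range (n + 1), ((min i m : ℕ) : ℝ) *
        truncField L n (euler L n h x₀ k) i := by
    rw [Finset.mul_sum, ← Finset.sum_add_distrib]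
    exact Finset.sum_congr rfl fun i _ => by rw [euler]; ring
  linarith

/-- Both conclusions must be carried together: positivity of the next step needs the bound `M` on
the entries, and that bound comes from dissipation, which needs positivity. -/
theorem euler_isState {L : ℕ → ℕ → ℝ} {θ : ℕ → ℝ} {C B : ℝ}
    (H : ProductBounds L θ C B) {n : ℕ} {h M : ℝ} (hh : 0 ≤ h) (hhn : h * rateBound L M n ≤ 1)
    {x₀ : ℕ → ℝ} (hx₀ : ∀ i, 0 ≤ x₀ i)
    (hM : ∑ i ∈ Finset.range (n + 1), ((min i 1 : ℕ) : ℝ) * x₀ i ≤ M) (k : ℕ) :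
    IsState n (euler L n h x₀ k) ∧
      ∑ i ∈ Finset.range (n + 1), ((min i 1 : ℕ) : ℝ) * euler L n h x₀ k i ≤ M := by
  induction k with
  | zero =>
    refine ⟨⟨fun i => ?_, by simp [euler], fun i hi => ?_⟩, le_trans (Finset.sum_le_sum ?_) hM⟩
    · simp only [euler]; split_ifs; exacts [hx₀ i, le_rfl]
    · simp only [euler]; rw [if_neg (by omega)]
    · intro i _
      refine mul_le_mul_of_nonneg_left ?_ (Nat.cast_nonneg _)
      simp only [euler]; split_ifs; exacts [le_rfl, hx₀ i]
  | succ k ih =>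
    refine ⟨ih.1.euler_step H.nonneg hh hhn fun i => (ih.1.le_sum_min i).trans ih.2, ?_⟩
    have := sum_min_mul_euler_succ_le H hh k ih.1 1
    have h0 : 0 ≤ h * (((1 : ℕ) : ℝ) / 2 *
      (∑ j ∈ Finset.Icc 1 n, θ j * euler L n h x₀ k j) ^ 2) := by positivity
    linarith [ih.2]


/-! ### Step functions in time and their a priori estimates -/

/-- Only finitely many values are taken on a bounded interval. No sign condition on `h` is needed:
division by zero gives `0`, and `⌊·⌋₊` sends negative reals to `0`. -/
theorem intervalIntegrable_comp_floor (f : ℕ → ℝ) (h a b : ℝ) :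
    IntervalIntegrable (fun s => f ⌊s / h⌋₊) volume a b := by
  have hm : Measurable fun s : ℝ => f ⌊s / h⌋₊ :=
    (measurable_of_countable f).comp (Nat.measurable_floor.comp (measurable_id.div_const h))
  rw [intervalIntegrable_iff]
  refine Measure.integrableOn_of_bounded (M := ∑ l ∈ Finset.range (⌊max |a| |b| / |h|⌋₊ + 1), |f l|)
    (by simp) hm.aestronglyMeasurable ?_
  refine (ae_restrict_iff' measurableSet_uIoc).mpr (Filter.Eventually.of_forall fun s hs => ?_)
  rw [Real.norm_eq_abs]
  refine Finset.single_le_sum (f := fun l => |f l|) (fun l _ => abs_nonneg _)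
    (Finset.mem_range.mpr (Nat.lt_succ_of_le (Nat.floor_le_floor ?_)))
  have hs' : |s| ≤ max |a| |b| := by
    rcases Set.mem_uIoc.mp hs with hs | hs
    · exact abs_le_max_abs_abs hs.1.le hs.2
    · rw [max_comm]; exact abs_le_max_abs_abs hs.1.le hs.2
  calc s / h ≤ |s / h| := le_abs_self _
    _ = |s| / |h| := abs_div s h
    _ ≤ _ := by gcongr

theorem integral_comp_floor (f : ℕ → ℝ) {h : ℝ} (hh : 0 < h) (k : ℕ) :
    ∫ s in (0 : ℝ)..(h * k), f ⌊s / h⌋₊ = ∑ l ∈ Finset.range k, h * f l := by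
  have h1 := intervalIntegral.sum_integral_adjacent_intervals (f := fun s => f ⌊s / h⌋₊)
    (μ := volume) (a := fun l : ℕ => h * l) (n := k)
    (fun l _ => intervalIntegrable_comp_floor f h _ _)
  rw [Nat.cast_zero, mul_zero] at h1
  rw [← h1]
  refine Finset.sum_congr rfl fun l _ => ?_
  have hle : h * l ≤ h * ((l + 1 : ℕ) : ℝ) := by gcongr; simp
  rw [intervalIntegral.integral_of_le hle, ← integral_Ico_eq_integral_Ioc,
    setIntegral_congr_fun (g := fun _ => f l) measurableSet_Ico]
  · simp only [setIntegral_const, smul_eq_mul]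
    rw [Measure.real, Real.volume_Ico, ENNReal.toReal_ofReal (by linarith)]
    push_cast; ring
  · intro s hs
    have : ⌊s / h⌋₊ = l := by
      rw [Nat.floor_eq_iff (div_nonneg ((by positivity : (0 : ℝ) ≤ h * l).trans hs.1) hh.le)]
      refine ⟨(le_div_iff₀ hh).mpr (by linarith [hs.1]), (div_lt_iff₀ hh).mpr ?_⟩
      have := hs.2
      push_cast at this; linarith
    simp only [this]

/-- A step function in time produced by the Euler scheme for the system truncated to sizes
`1, …, n`, together with its a priori estimates. -/
structure IsApproximation (L : ℕ → ℕ → ℝ) (θ : ℕ → ℝ) (B M : ℝ) (x₀ : ℕ → ℝ) (n : ℕ) (h : ℝ)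
    (v : ℝ → ℕ → ℝ) : Prop where
  step_pos : 0 < h
  state : ∀ s, IsState n (v s)
  mass : ∀ s, ∑ i ∈ Finset.range (n + 1), v s i ≤ M
  integrable : ∀ (F : (ℕ → ℝ) → ℝ) (a b : ℝ), IntervalIntegrable (fun s => F (v s)) volume a b
  dissipation : ∀ (m : ℕ) (t : ℝ), 0 ≤ t →
    ∫ s in (0 : ℝ)..t, (m : ℝ) / 2 * (∑ j ∈ Finset.Icc m n, θ j * v s j) ^ 2 ≤
      ∑ i ∈ Finset.range (n + 1), ((min i m : ℕ) : ℝ) * x₀ i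
  moment : ∀ t, 0 ≤ t → (t - h) * (B * ∑ i ∈ Finset.range (n + 1), (i : ℝ) * v t i) ^ 2 ≤ 2 * M
  eq_integral : ∀ t, 0 ≤ t → ∀ i, 1 ≤ i → i ≤ n →
    v t i = x₀ i + ∫ s in (0 : ℝ)..(h * ⌊t / h⌋₊), truncField L n (v s) i

theorem sum_min_one_mul {n : ℕ} {x : ℕ → ℝ} (hx : IsState n x) :
    ∑ i ∈ Finset.range (n + 1), ((min i 1 : ℕ) : ℝ) * x i = ∑ i ∈ Finset.range (n + 1), x i := by
  refine Finset.sum_congr rfl fun i _ => ?_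
  rcases Nat.eq_zero_or_pos i with rfl | hi
  · simp [hx.zero]
  · rw [min_eq_right hi, Nat.cast_one, one_mul]

theorem exists_isApproximation {L : ℕ → ℕ → ℝ} {θ : ℕ → ℝ} {C B : ℝ}
    (H : ProductBounds L θ C B) {M : ℝ} {x₀ : ℕ → ℝ} (hx₀ : ∀ i, 0 ≤ x₀ i) (n : ℕ)
    (hM : ∑ i ∈ Finset.range (n + 1), x₀ i ≤ M) :
    ∃ h : ℝ, h ≤ 1 / ((n : ℝ) + 1) ∧ ∃ v, IsApproximation L θ B M x₀ n h v := by
  have hM0 : 0 ≤ M := (Finset.sum_nonneg fun i _ => hx₀ i).trans hM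
  have hE := rateBound_nonneg H.nonneg hM0 n
  set E := rateBound L M n with hEdef
  have hpos : 0 < (n : ℝ) + 1 + E := by positivity
  -- One choice serves both needs: `h ≤ 1 / (n + 1)` forces the steps to zero, and `h * E ≤ 1`
  -- preserves positivity.
  set h : ℝ := 1 / ((n : ℝ) + 1 + E) with hdef
  have hh : 0 < h := by positivity
  have hhn : h * rateBound L M n ≤ 1 := by
    rw [hdef, ← hEdef, one_div_mul_eq_div, div_le_one hpos]
    have : (0 : ℝ) ≤ n := Nat.cast_nonneg n
    linarith
  have hM1 : ∑ i ∈ Finset.range (n + 1), ((min i 1 : ℕ) : ℝ) * x₀ i ≤ M := by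
    refine (Finset.sum_le_sum fun i _ => ?_).trans hM
    refine mul_le_of_le_one_left (hx₀ i) ?_
    exact_mod_cast min_le_right i 1
  have hst := euler_isState H hh.le hhn hx₀ hM1
  have hdis : ∀ m k : ℕ, ∑ i ∈ Finset.range (n + 1), ((min i m : ℕ) : ℝ) * euler L n h x₀ k i +
      ∑ l ∈ Finset.range k,
        h * ((m : ℝ) / 2 * (∑ j ∈ Finset.Icc m n, θ j * euler L n h x₀ l j) ^ 2) ≤
      ∑ i ∈ Finset.range (n + 1), ((min i m : ℕ) : ℝ) * x₀ i := by
    intro m k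
    induction k with
    | zero =>
      simp only [Finset.range_zero, Finset.sum_empty, add_zero]
      refine Finset.sum_le_sum fun i _ => mul_le_mul_of_nonneg_left ?_ (Nat.cast_nonneg _)
      simp only [euler]; split_ifs; exacts [le_rfl, hx₀ i]
    | succ k ih =>
      rw [Finset.sum_range_succ _ k]
      linarith [sum_min_mul_euler_succ_le H hh.le k (hst k).1 m]
  have hdis' : ∀ m k : ℕ, ∑ l ∈ Finset.range k,
        h * ((m : ℝ) / 2 * (∑ j ∈ Finset.Icc m n, θ j * euler L n h x₀ l j) ^ 2) ≤
      ∑ i ∈ Finset.range (n + 1), ((min i m : ℕ) : ℝ) * x₀ i := fun m k =>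
    le_trans (le_add_of_nonneg_left (Finset.sum_nonneg fun i _ =>
      mul_nonneg (Nat.cast_nonneg _) ((hst k).1.nonneg i))) (hdis m k)
  refine ⟨h, ?_, fun s => euler L n h x₀ ⌊s / h⌋₊, ?_⟩
  · exact one_div_le_one_div_of_le (by positivity) (by linarith)
  have hint : ∀ (F : (ℕ → ℝ) → ℝ) (a b : ℝ),
      IntervalIntegrable (fun s => F (euler L n h x₀ ⌊s / h⌋₊)) volume a b := fun F a b =>
    intervalIntegrable_comp_floor (fun k => F (euler L n h x₀ k)) h a b
  refine ⟨hh, fun s => (hst _).1, fun s => ?_, hint, ?_, ?_, ?_⟩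
  · rw [← sum_min_one_mul (hst _).1]; exact (hst _).2
  · intro m t ht
    -- One extra step makes the grid cover all of `[0, t]`.
    refine le_trans ?_ (hdis' m (⌊t / h⌋₊ + 1))
    rw [← integral_comp_floor (fun l =>
      (m : ℝ) / 2 * (∑ j ∈ Finset.Icc m n, θ j * euler L n h x₀ l j) ^ 2) hh]
    have htk : t ≤ h * ((⌊t / h⌋₊ + 1 : ℕ) : ℝ) := by
      have := (Nat.lt_floor_add_one (t / h)).le
      rw [div_le_iff₀ hh] at this
      push_cast; linarith
    refine intervalIntegral.integral_mono_interval le_rfl ht htk ?_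
      (hint (fun x => (m : ℝ) / 2 * (∑ j ∈ Finset.Icc m n, θ j * x j) ^ 2) _ _)
    exact Filter.Eventually.of_forall fun s => by positivity
  · intro t ht
    have htk : t - h ≤ h * ⌊t / h⌋₊ := by
      have := (Nat.lt_floor_add_one (t / h)).le
      rw [div_le_iff₀ hh] at this
      linarith
    generalize ⌊t / h⌋₊ = k at htk ⊢
    refine (mul_le_mul_of_nonneg_right htk (sq_nonneg _)).trans ?_
    -- On sizes up to `n` the weight with `m = n` is the size itself, so dissipation makes the first
    -- moment nonincreasing in time.
    have hp : ∀ l, ∑ i ∈ Finset.range (n + 1), ((min i n : ℕ) : ℝ) * euler L n h x₀ l i =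
        ∑ i ∈ Finset.range (n + 1), (i : ℝ) * euler L n h x₀ l i := fun l =>
      Finset.sum_congr rfl fun i hi => by
        rw [min_eq_left (Nat.lt_succ_iff.mp (Finset.mem_range.mp hi))]
    have hanti : Antitone fun l => ∑ i ∈ Finset.range (n + 1), (i : ℝ) * euler L n h x₀ l i := by
      refine antitone_nat_of_succ_le fun l => ?_
      rw [← hp, ← hp]
      refine le_trans (le_add_of_nonneg_right ?_) (sum_min_mul_euler_succ_le H hh.le l (hst l).1 n)
      positivity
    have hS : ∀ l, l < k → (B * ∑ i ∈ Finset.range (n + 1), (i : ℝ) * euler L n h x₀ k i) ^ 2 ≤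
        (∑ j ∈ Finset.Icc 1 n, θ j * euler L n h x₀ l j) ^ 2 := by
      intro l hl
      refine pow_le_pow_left₀ (mul_nonneg H.B_pos.le (Finset.sum_nonneg fun i _ =>
        mul_nonneg (Nat.cast_nonneg i) ((hst k).1.nonneg i))) ?_ 2
      refine (mul_le_mul_of_nonneg_left (hanti hl.le) H.B_pos.le).trans ?_
      beta_reduce
      rw [Finset.range_eq_Ico, Finset.sum_eq_sum_Ico_succ_bot (Nat.succ_pos n), Nat.cast_zero,
        zero_mul, zero_add, zero_add, Finset.mul_sum, ← Finset.Ico_add_one_right_eq_Icc]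
      refine Finset.sum_le_sum fun i _ => ?_
      rw [← mul_assoc]
      exact mul_le_mul_of_nonneg_right (H.linear i) ((hst l).1.nonneg i)
    -- The case `m = 1` bounds the time sum of squared `θ`-moments. By monotonicity each of the `k`
    -- summands dominates the value at the final step.
    have h1 := (hdis' 1 k).trans hM1
    have h2 : (k : ℝ) * (h * (1 / 2 *
        (B * ∑ i ∈ Finset.range (n + 1), (i : ℝ) * euler L n h x₀ k i) ^ 2)) ≤ M := by
      refine le_trans ?_ h1
      rw [← nsmul_eq_mul, ← Finset.card_range k, ← Finset.sum_const, Finset.card_range]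
      refine Finset.sum_le_sum fun l hl => ?_
      rw [Nat.cast_one]
      have := hS l (Finset.mem_range.mp hl)
      gcongr
    linarith
  · intro t _ i hi hin
    rw [integral_comp_floor (fun l => truncField L n (euler L n h x₀ l) i) hh]
    generalize ⌊t / h⌋₊ = k
    induction k with
    | zero => simp [euler, hi, hin]
    | succ k ih => rw [Finset.sum_range_succ, ← add_assoc, ← ih, euler]


/-! ### Uniform tails, equi-integrability and compactness -/

theorem IsState.le_mass {n : ℕ} {x : ℕ → ℝ} (hx : IsState n x) (i : ℕ) :
    x i ≤ ∑ i ∈ Finset.range (n + 1), x i := by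
  rw [← sum_min_one_mul hx]; exact hx.le_sum_min i

/-- Dominated convergence: the factor `min i m / m` is at most one and tends to zero for fixed `i`.
Summability of the datum is enough; no higher moment enters. -/
theorem tendsto_tsum_min_div {x₀ : ℕ → ℝ} (hx₀ : ∀ i, 0 ≤ x₀ i) (hs : Summable x₀) :
    Tendsto (fun m : ℕ => ∑' i, ((min i m : ℕ) : ℝ) / m * x₀ i) atTop (𝓝 0) := by
  have h0 : (0 : ℝ) = ∑' _ : ℕ, (0 : ℝ) := tsum_zero.symm
  rw [h0]
  refine tendsto_tsum_of_dominated_convergence hs (fun i => ?_) (Eventually.of_forall fun m i => ?_)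
  · have h1 : Tendsto (fun m : ℕ => (i : ℝ) / m * x₀ i) atTop (𝓝 (0 * x₀ i)) :=
      (tendsto_const_div_atTop_nhds_zero_nat (i : ℝ)).mul_const _
    rw [zero_mul] at h1
    refine h1.congr' ?_
    filter_upwards [eventually_ge_atTop i] with m hm
    rw [min_eq_left hm]
  · rw [Real.norm_eq_abs, abs_of_nonneg (mul_nonneg (by positivity) (hx₀ i))]
    refine mul_le_of_le_one_left (hx₀ i) (div_le_one_of_le₀ ?_ (Nat.cast_nonneg m))
    exact_mod_cast min_le_right i m

theorem IsApproximation.le_M {L : ℕ → ℕ → ℝ} {θ : ℕ → ℝ} {B M : ℝ} {x₀ : ℕ → ℝ} {n : ℕ} {h : ℝ}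
    {v : ℝ → ℕ → ℝ} (V : IsApproximation L θ B M x₀ n h v) (s : ℝ) (i : ℕ) : v s i ≤ M :=
  ((V.state s).le_mass i).trans (V.mass s)

/-- The dissipation estimate as an `L²` estimate. -/
theorem IsApproximation.integral_sq_le {L : ℕ → ℕ → ℝ} {θ : ℕ → ℝ} {B M : ℝ} {x₀ : ℕ → ℝ} {n : ℕ}
    {h : ℝ} {v : ℝ → ℕ → ℝ} (V : IsApproximation L θ B M x₀ n h v) (hx₀ : ∀ i, 0 ≤ x₀ i)
    (hs : Summable x₀) {m : ℕ} (hm : 1 ≤ m) {t : ℝ} (ht : 0 ≤ t) :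
    ∫ s in (0 : ℝ)..t, (∑ j ∈ Finset.Icc m n, θ j * v s j) ^ 2 ≤
      2 * ∑' i, ((min i m : ℕ) : ℝ) / m * x₀ i := by
  have hm0 : (0 : ℝ) < m := by exact_mod_cast hm
  have h1 := V.dissipation m t ht
  rw [intervalIntegral.integral_const_mul] at h1
  have hsum : Summable fun i => ((min i m : ℕ) : ℝ) / m * x₀ i := by
    refine Summable.of_nonneg_of_le (fun i => mul_nonneg (by positivity) (hx₀ i)) (fun i => ?_) hs
    refine mul_le_of_le_one_left (hx₀ i) (div_le_one_of_le₀ ?_ (Nat.cast_nonneg m))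
    exact_mod_cast min_le_right i m
  have h2 := hsum.sum_le_tsum (Finset.range (n + 1))
    fun i _ => mul_nonneg (by positivity) (hx₀ i)
  have h3 : ∑ i ∈ Finset.range (n + 1), ((min i m : ℕ) : ℝ) * x₀ i =
      m * ∑ i ∈ Finset.range (n + 1), ((min i m : ℕ) : ℝ) / m * x₀ i := by
    rw [Finset.mul_sum]
    exact Finset.sum_congr rfl fun i _ => by field_simp
  rw [h3] at h1
  have h4 : (m : ℝ) * ((∫ s in (0 : ℝ)..t, (∑ j ∈ Finset.Icc m n, θ j * v s j) ^ 2) / 2) ≤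
      m * ∑ i ∈ Finset.range (n + 1), ((min i m : ℕ) : ℝ) / m * x₀ i := by linarith
  have h5 := le_of_mul_le_mul_left h4 hm0
  linarith

/-- Young's inequality. Its free parameter turns `L²` estimates in time into `L¹` smallness. -/
theorem le_add_mul_sq {c : ℝ} (hc : 0 < c) (S : ℝ) : S ≤ 1 / (4 * c) + c * S ^ 2 := by
  have h := mul_nonneg hc.le (sq_nonneg (S - 1 / (2 * c)))
  have e : c * (S - 1 / (2 * c)) ^ 2 = c * S ^ 2 - S + 1 / (4 * c) := by field_simp; ring
  linarith

/-- Uniform smallness of the tails of the `θ`-moment. -/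
theorem exists_tail_le {L : ℕ → ℕ → ℝ} {θ : ℕ → ℝ} {B M : ℝ} {x₀ : ℕ → ℝ}
    (hx₀ : ∀ i, 0 ≤ x₀ i) (hs : Summable x₀) {t η : ℝ} (ht : 0 ≤ t) (hη : 0 < η) :
    ∃ m : ℕ, ∀ n h v, IsApproximation L θ B M x₀ n h v →
      ∫ s in (0 : ℝ)..t, ∑ j ∈ Finset.Icc m n, θ j * v s j ≤ η := by
  -- The constant part of Young's inequality then integrates to at most `η / 2`; `m` is chosen
  -- afterwards to make the quadratic part at most `η / 2`. Using `t + 1` covers `t = 0`.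
  set c : ℝ := (t + 1) / (2 * η) with hc
  have hc0 : 0 < c := by positivity
  have hlim := (tendsto_tsum_min_div hx₀ hs).const_mul (2 * c)
  rw [mul_zero] at hlim
  obtain ⟨m, hm, hm1⟩ := ((hlim.eventually_lt_const (half_pos hη)).and (eventually_ge_atTop 1)).exists
  refine ⟨m, fun n h v V => ?_⟩
  have h1 := V.integral_sq_le hx₀ hs hm1 ht
  have hi := V.integrable (fun x => (∑ j ∈ Finset.Icc m n, θ j * x j) ^ 2) 0 t
  calc ∫ s in (0 : ℝ)..t, ∑ j ∈ Finset.Icc m n, θ j * v s j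
      ≤ ∫ s in (0 : ℝ)..t, (1 / (4 * c) + c * (∑ j ∈ Finset.Icc m n, θ j * v s j) ^ 2) :=
        intervalIntegral.integral_mono_on ht
          (V.integrable (fun x => ∑ j ∈ Finset.Icc m n, θ j * x j) 0 t)
          (V.integrable (fun x => 1 / (4 * c) + c * (∑ j ∈ Finset.Icc m n, θ j * x j) ^ 2) 0 t)
          fun s _ => le_add_mul_sq hc0 _
    _ = t * (1 / (4 * c)) + c * ∫ s in (0 : ℝ)..t, (∑ j ∈ Finset.Icc m n, θ j * v s j) ^ 2 := by
        rw [intervalIntegral.integral_add (by simp) (hi.const_mul c),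
          intervalIntegral.integral_const_mul, intervalIntegral.integral_const, smul_eq_mul]
        rw [sub_zero]
    _ ≤ η / 2 + η / 2 := by
        refine add_le_add ?_ ?_
        · rw [hc]
          field_simp
          nlinarith
        · have := mul_le_mul_of_nonneg_left h1 hc0.le
          linarith
    _ = η := add_halves η

/-- A bound for the truncated field, uniform in the truncation. -/
theorem exists_abs_truncField_le {L : ℕ → ℕ → ℝ} {θ : ℕ → ℝ} {C B : ℝ}
    (H : ProductBounds L θ C B) {M : ℝ} (hM : 0 ≤ M) (i : ℕ) :
    ∃ D : ℝ, 0 ≤ D ∧ ∀ n x, IsState n x → (∀ j, x j ≤ M) →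
      |truncField L n x i| ≤ D * (1 + ∑ j ∈ Finset.Icc 1 n, θ j * x j) := by
  have hL := H.nonneg
  have hflux : ∀ n x, IsState n x → (∀ j, x j ≤ M) → ∀ k,
      flux L x k ≤ M * ∑ j ∈ Finset.range (k + 1), (j : ℝ) * L k j * M := by
    intro n x hx hxM k
    refine mul_le_mul (hxM k) (Finset.sum_le_sum fun j _ => ?_) (Finset.sum_nonneg fun j _ => ?_) hM
    · exact mul_le_mul_of_nonneg_left (hxM j) (mul_nonneg (Nat.cast_nonneg j) (hL k j))
    · exact mul_nonneg (mul_nonneg (Nat.cast_nonneg j) (hL k j)) (hx.nonneg j)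
  have hfb : ∀ k, 0 ≤ M * ∑ j ∈ Finset.range (k + 1), (j : ℝ) * L k j * M := fun k =>
    mul_nonneg hM (Finset.sum_nonneg fun j _ =>
      mul_nonneg (mul_nonneg (Nat.cast_nonneg j) (hL k j)) hM)
  cases i with
  | zero => exact ⟨0, le_rfl, fun n x _ _ => by simp [truncField]⟩
  | succ i =>
    have hC := H.C_nonneg
    have hθ := H.theta_nonneg
    set F := fun k => M * ∑ j ∈ Finset.range (k + 1), (j : ℝ) * L k j * M with hF
    have hE : 0 ≤ M * (C * θ (i + 1)) := mul_nonneg hM (mul_nonneg hC (hθ _))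
    refine ⟨F i + F (i + 1) + M * (C * θ (i + 1)), by
      linarith [hfb i, hfb (i + 1)], fun n x hx hxM => ?_⟩
    have hS : 0 ≤ ∑ j ∈ Finset.Icc 1 n, θ j * x j := Finset.sum_nonneg fun j _ =>
      mul_nonneg (hθ j) (hx.nonneg j)
    have hl0 : 0 ≤ ∑ j ∈ Finset.Icc (i + 1) n, L (i + 1) j * x (i + 1) * x j :=
      Finset.sum_nonneg fun j _ => mul_nonneg (mul_nonneg (hL _ j) (hx.nonneg _)) (hx.nonneg j)
    have hl1 : ∑ j ∈ Finset.Icc (i + 1) n, L (i + 1) j * x (i + 1) * x j ≤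
        M * (C * θ (i + 1)) * ∑ j ∈ Finset.Icc 1 n, θ j * x j := by
      rw [Finset.mul_sum]
      refine (Finset.sum_le_sum fun j _ => ?_).trans (Finset.sum_le_sum_of_subset_of_nonneg
        (Finset.Icc_subset_Icc (by omega) le_rfl) fun j _ _ =>
          mul_nonneg hE (mul_nonneg (hθ j) (hx.nonneg j)))
      have e1 := mul_le_mul (H.kernel_le (i + 1) j) (hxM (i + 1)) (hx.nonneg _)
        (mul_nonneg hC (mul_nonneg (hθ _) (hθ j)))
      have e2 := mul_le_mul_of_nonneg_right e1 (hx.nonneg j)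
      linarith
    have f1 := hflux n x hx hxM i
    have f2 := hflux n x hx hxM (i + 1)
    have f3 := flux_nonneg hL hx.nonneg i
    have f4 := flux_nonneg hL hx.nonneg (i + 1)
    have g1 := mul_nonneg (hfb i) hS
    have g2 := mul_nonneg (hfb (i + 1)) hS
    simp only [truncField]
    split_ifs
    · rw [abs_le]
      constructor <;> simp only [hF] <;> linarith
    · rw [abs_zero]
      exact mul_nonneg (by simp only [hF]; linarith [hfb i, hfb (i + 1)]) (by linarith)

/-- Equi-integrability in time of the truncated fields. -/
theorem exists_modulus {L : ℕ → ℕ → ℝ} {θ : ℕ → ℝ} {C B : ℝ}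
    (H : ProductBounds L θ C B) {M : ℝ} (hM : 0 ≤ M) {x₀ : ℕ → ℝ} (hx₀ : ∀ i, 0 ≤ x₀ i)
    (hs : Summable x₀) (i : ℕ) {ε : ℝ} (hε : 0 < ε) :
    ∃ δ : ℝ, 0 < δ ∧ ∀ n h v, IsApproximation L θ B M x₀ n h v → ∀ a b : ℝ, 0 ≤ a → a ≤ b →
      b - a ≤ δ → |∫ s in a..b, truncField L n (v s) i| ≤ ε := by
  obtain ⟨D, hD0, hD⟩ := exists_abs_truncField_le H hM i
  set Q : ℝ := 2 * ∑' i, ((min i 1 : ℕ) : ℝ) / (1 : ℕ) * x₀ i with hQ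
  have hQ0 : 0 ≤ Q := mul_nonneg zero_le_two (tsum_nonneg fun i => mul_nonneg (by positivity) (hx₀ i))
  -- `c` makes the quadratic part of Young's inequality at most `ε / 2`, then `δ` does the same for
  -- the constant part. The shifts `D + 1` and `Q + 1` avoid zero denominators.
  set c : ℝ := ε / (2 * (D + 1) * (Q + 1)) with hc
  have hc0 : 0 < c := by positivity
  set δ : ℝ := ε / (2 * (D + 1) * (1 + 1 / (4 * c))) with hδ
  refine ⟨δ, by positivity, fun n h v V a b ha hab hba => ?_⟩
  have hi := V.integrable (fun x => (∑ j ∈ Finset.Icc 1 n, θ j * x j) ^ 2) a b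
  have h1 : ∫ s in a..b, (∑ j ∈ Finset.Icc 1 n, θ j * v s j) ^ 2 ≤ Q := by
    refine le_trans ?_ (V.integral_sq_le hx₀ hs le_rfl (ha.trans hab))
    exact intervalIntegral.integral_mono_interval ha hab le_rfl
      (Eventually.of_forall fun s => sq_nonneg _)
      (V.integrable (fun x => (∑ j ∈ Finset.Icc 1 n, θ j * x j) ^ 2) 0 b)
  calc |∫ s in a..b, truncField L n (v s) i|
      ≤ ∫ s in a..b, |truncField L n (v s) i| := intervalIntegral.abs_integral_le_integral_abs hab
    _ ≤ ∫ s in a..b, (D * (1 + 1 / (4 * c)) +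
          D * c * (∑ j ∈ Finset.Icc 1 n, θ j * v s j) ^ 2) := by
        refine intervalIntegral.integral_mono_on hab
          (V.integrable (fun x => |truncField L n x i|) a b)
          (V.integrable (fun x => D * (1 + 1 / (4 * c)) +
            D * c * (∑ j ∈ Finset.Icc 1 n, θ j * x j) ^ 2) a b) fun s _ => ?_
        refine (hD n (v s) (V.state s) (V.le_M s)).trans ?_
        have := mul_le_mul_of_nonneg_left
          (le_add_mul_sq hc0 (∑ j ∈ Finset.Icc 1 n, θ j * v s j)) hD0
        linarith
    _ = (b - a) * (D * (1 + 1 / (4 * c))) +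
          D * c * ∫ s in a..b, (∑ j ∈ Finset.Icc 1 n, θ j * v s j) ^ 2 := by
        rw [intervalIntegral.integral_add (by simp) (hi.const_mul _),
          intervalIntegral.integral_const, intervalIntegral.integral_const_mul, smul_eq_mul]
    _ ≤ ε / 2 + ε / 2 := by
        refine add_le_add ?_ ?_
        · calc (b - a) * (D * (1 + 1 / (4 * c))) ≤ δ * ((D + 1) * (1 + 1 / (4 * c))) := by
                gcongr; linarith
            _ = ε / 2 := by rw [hδ]; field_simp
        · calc D * c * ∫ s in a..b, (∑ j ∈ Finset.Icc 1 n, θ j * v s j) ^ 2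
              ≤ (D + 1) * c * (Q + 1) := by
                have h2 : ∫ s in a..b, (∑ j ∈ Finset.Icc 1 n, θ j * v s j) ^ 2 ≤ Q + 1 := by linarith
                have h3 := mul_le_mul_of_nonneg_left h2 (mul_nonneg hD0 hc0.le)
                have h4 : 0 ≤ c * (Q + 1) := by positivity
                linarith
            _ = ε / 2 := by rw [hc]; field_simp
    _ = ε := add_halves ε

/-- Step functions are equicontinuous only up to one time step: the grid points below `s` and `t`
can be `t - s + h` apart. -/
theorem IsApproximation.abs_sub_le {L : ℕ → ℕ → ℝ} {θ : ℕ → ℝ} {B M : ℝ} {x₀ : ℕ → ℝ} {n : ℕ}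
    {h : ℝ} {v : ℝ → ℕ → ℝ} (V : IsApproximation L θ B M x₀ n h v) {i : ℕ} (hin : i ≤ n)
    {δ ε : ℝ} (hε : 0 ≤ ε) (hδ : ∀ a b : ℝ, 0 ≤ a → a ≤ b → b - a ≤ δ →
      |∫ s in a..b, truncField L n (v s) i| ≤ ε) {s t : ℝ} (hs : 0 ≤ s) (hst : s ≤ t)
    (hts : t - s + h ≤ δ) : |v t i - v s i| ≤ ε := by
  rcases Nat.eq_zero_or_pos i with rfl | hi
  · simpa [(V.state _).zero] using hε
  have hh := V.step_pos
  rw [V.eq_integral t (hs.trans hst) i hi hin, V.eq_integral s hs i hi hin, add_sub_add_left_eq_sub,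
    intervalIntegral.integral_interval_sub_left
      (V.integrable (fun x => truncField L n x i) _ _)
      (V.integrable (fun x => truncField L n x i) _ _)]
  refine hδ _ _ (by positivity) ?_ ?_
  · gcongr
  · have h1 := (Nat.lt_floor_add_one (s / h)).le
    rw [div_le_iff₀ hh] at h1
    have h2 := Nat.floor_le (div_nonneg (hs.trans hst) hh.le)
    rw [le_div_iff₀ hh] at h2
    linarith

/-- A subsequence of the approximations converges at all nonnegative times. -/
theorem exists_subseq_tendsto {L : ℕ → ℕ → ℝ} {θ : ℕ → ℝ} {C B : ℝ}
    (H : ProductBounds L θ C B) {M : ℝ} (hM : 0 ≤ M) {x₀ : ℕ → ℝ} (hx₀ : ∀ i, 0 ≤ x₀ i)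
    (hs : Summable x₀) {h : ℕ → ℝ} (hh : Tendsto h atTop (𝓝 0)) {v : ℕ → ℝ → ℕ → ℝ}
    (V : ∀ n, IsApproximation L θ B M x₀ n (h n) (v n)) :
    ∃ φ : ℕ → ℕ, StrictMono φ ∧ ∃ w : ℝ → ℕ → ℝ, ∀ t, 0 ≤ t → ∀ i,
      Tendsto (fun n => v (φ n) t i) atTop (𝓝 (w t i)) := by
  -- Compactness of a countable product replaces a diagonal extraction: one subsequence converges at
  -- all rational times and all sizes.
  have hK : IsCompact (Set.univ.pi fun _ : ℚ × ℕ => Set.Icc (0 : ℝ) M) :=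
    isCompact_univ_pi fun _ => isCompact_Icc
  obtain ⟨g, -, φ, hφ, hg⟩ := hK.tendsto_subseq (x := fun n (p : ℚ × ℕ) => v n (p.1 : ℝ) p.2)
    fun n p _ => ⟨((V n).state _).nonneg _, (V n).le_M _ _⟩
  refine ⟨φ, hφ, ?_⟩
  rw [tendsto_pi_nhds] at hg
  suffices ∀ t : ℝ, 0 ≤ t → ∀ i, ∃ y, Tendsto (fun n => v (φ n) t i) atTop (𝓝 y) by
    choose w hw using this
    refine ⟨fun t i => if ht : 0 ≤ t then w t ht i else 0, fun t ht i => ?_⟩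
    simpa [ht] using hw t ht i
  intro t ht i
  refine cauchySeq_tendsto_of_complete (Metric.cauchySeq_iff'.mpr fun ε hε => ?_)
  obtain ⟨δ, hδ, hmod⟩ := exists_modulus H hM hx₀ hs i (by positivity : 0 < ε / 5)
  -- Half of `δ` is for the distance to the rational time, the other half for the time step.
  obtain ⟨q, hq1, hq2⟩ := exists_rat_btwn (show t < t + δ / 2 by linarith)
  have hc := Metric.cauchySeq_iff.mp (hg (q, i)).cauchySeq (ε / 5) (by positivity)
  obtain ⟨N1, hN1⟩ := hc
  have hev := ((hh.comp hφ.tendsto_atTop).eventually_lt_const (half_pos hδ)).and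
    (hφ.tendsto_atTop.eventually_ge_atTop i)
  obtain ⟨N2, hN2⟩ := eventually_atTop.mp hev
  have key : ∀ n ≥ N2, |v (φ n) q i - v (φ n) t i| ≤ ε / 5 := fun n hn =>
    (V (φ n)).abs_sub_le (hN2 n hn).2 (by positivity) (hmod _ _ _ (V (φ n))) ht hq1.le (by
      have := (hN2 n hn).1
      simp only [Function.comp] at this
      linarith)
  refine ⟨max N1 N2, fun n hn => ?_⟩
  have k1 := key n (le_trans (le_max_right _ _) hn)
  have k2 := key (max N1 N2) (le_max_right _ _)
  have k3 := hN1 n (le_trans (le_max_left _ _) hn) (max N1 N2) (le_max_left _ _)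
  rw [Real.dist_eq] at k3 ⊢
  simp only [Function.comp] at k3
  rw [abs_le] at k1 k2
  rw [abs_lt] at k3 ⊢
  constructor <;> linarith [k1.1, k1.2, k2.1, k2.2, k3.1, k3.2]


/-! ### Interchanging series with integrals and limits -/

/-- Tonelli in `ℝ≥0∞`: the sum has finite integral, hence is finite almost everywhere. -/
theorem ae_summable_and_integrable_tsum {α : Type*} [MeasurableSpace α] {μ : Measure α}
    {F : ℕ → α → ℝ} (hF0 : ∀ i, ∀ᵐ a ∂μ, 0 ≤ F i a) (hF : ∀ i, Integrable (F i) μ)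
    (hs : Summable fun i => ∫ a, F i a ∂μ) :
    (∀ᵐ a ∂μ, Summable fun i => F i a) ∧ Integrable (fun a => ∑' i, F i a) μ := by
  have hm : ∀ i, AEMeasurable (fun a => ENNReal.ofReal (F i a)) μ := fun i =>
    (hF i).1.aemeasurable.ennreal_ofReal
  have h1 : ∫⁻ a, ∑' i, ENNReal.ofReal (F i a) ∂μ ≠ ∞ := by
    rw [lintegral_tsum hm]
    simp_rw [← fun i => ofReal_integral_eq_lintegral_ofReal (hF i) (hF0 i)]
    rw [← ENNReal.ofReal_tsum_of_nonneg (fun i => integral_nonneg_of_ae (hF0 i)) hs]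
    exact ENNReal.ofReal_ne_top
  have h0 : ∀ᵐ a ∂μ, ∀ i, 0 ≤ F i a := ae_all_iff.mpr hF0
  constructor
  · filter_upwards [ae_lt_top' (AEMeasurable.tsum hm) h1, h0] with a ha ha0
    refine (ENNReal.summable_toReal ha.ne).congr fun i => ?_
    rw [ENNReal.toReal_ofReal (ha0 i)]
  · refine (integrable_toReal_of_lintegral_ne_top (AEMeasurable.tsum hm) h1).congr ?_
    filter_upwards [h0] with a ha0
    rw [ENNReal.tsum_toReal_eq fun _ => ENNReal.ofReal_ne_top]
    exact tsum_congr fun i => ENNReal.toReal_ofReal (ha0 i)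

/-- Cut at a fixed `m`: the heads converge termwise, and the tails of both the approximations and
the limit are small. -/
theorem tendsto_sum_of_uniform_tail {b : ℕ → ℕ → ℝ} {c : ℕ → ℝ} {N : ℕ → ℕ}
    (hN : Tendsto N atTop atTop) (hb : ∀ j, Tendsto (fun n => b n j) atTop (𝓝 (c j)))
    (hb0 : ∀ n j, 0 ≤ b n j)
    (htail : ∀ η > 0, ∃ m, ∀ n, ∑ j ∈ Finset.Icc m (N n), b n j ≤ η) (hc : Summable c) :
    Tendsto (fun n => ∑ j ∈ Finset.range (N n + 1), b n j) atTop (𝓝 (∑' j, c j)) := by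
  refine Metric.tendsto_atTop'.mpr fun ε hε => ?_
  obtain ⟨m₀, hm₀⟩ := htail (ε / 3) (by positivity)
  obtain ⟨m, hm1, hm2⟩ := ((Metric.tendsto_nhds.mp hc.hasSum.tendsto_sum_nat (ε / 3)
    (by positivity)).and (eventually_ge_atTop m₀)).exists
  have h1 := Metric.tendsto_nhds.mp
    (tendsto_finsetSum (Finset.range m) fun j _ => hb j) (ε / 3) (by positivity)
  obtain ⟨n₀, hn₀⟩ := eventually_atTop.mp (h1.and (hN.eventually_ge_atTop m))
  refine ⟨n₀, fun n hn => ?_⟩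
  obtain ⟨h2, h3⟩ := hn₀ n hn.le
  have h4 : ∑ j ∈ Finset.range (N n + 1), b n j =
      ∑ j ∈ Finset.range m, b n j + ∑ j ∈ Finset.Icc m (N n), b n j := by
    rw [← Finset.Ico_add_one_right_eq_Icc, Finset.sum_range_add_sum_Ico _ (by omega)]
  have h5 : ∑ j ∈ Finset.Icc m (N n), b n j ≤ ε / 3 :=
    (Finset.sum_le_sum_of_subset_of_nonneg (Finset.Icc_subset_Icc hm2 le_rfl)
      fun j _ _ => hb0 n j).trans (hm₀ n)
  have h6 : 0 ≤ ∑ j ∈ Finset.Icc m (N n), b n j := Finset.sum_nonneg fun j _ => hb0 n j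
  rw [Real.dist_eq, abs_lt] at *
  constructor <;> linarith [hm1.1, hm1.2, h2.1, h2.2]

/-! ### Passage to the limit -/

/-- A sequence of approximations, with truncations tending to infinity and time steps tending to
zero, that converges at all nonnegative times. -/
structure ConvergentApproximation (L : ℕ → ℕ → ℝ) (θ : ℕ → ℝ) (B M : ℝ) (x₀ : ℕ → ℝ) (N : ℕ → ℕ)
    (h : ℕ → ℝ) (v : ℕ → ℝ → ℕ → ℝ) (w : ℝ → ℕ → ℝ) : Prop where
  approx : ∀ n, IsApproximation L θ B M x₀ (N n) (h n) (v n)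
  truncation : Tendsto N atTop atTop
  step : Tendsto h atTop (𝓝 0)
  tendsto : ∀ t, 0 ≤ t → ∀ i, Tendsto (fun n => v n t i) atTop (𝓝 (w t i))

namespace ConvergentApproximation

variable {L : ℕ → ℕ → ℝ} {θ : ℕ → ℝ} {C B M : ℝ} {x₀ : ℕ → ℝ} {N : ℕ → ℕ}
    {h : ℕ → ℝ} {v : ℕ → ℝ → ℕ → ℝ} {w : ℝ → ℕ → ℝ}

theorem nonneg (W : ConvergentApproximation L θ B M x₀ N h v w) {t : ℝ} (ht : 0 ≤ t) (i : ℕ) :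
    0 ≤ w t i :=
  ge_of_tendsto' (W.tendsto t ht i) fun n => ((W.approx n).state t).nonneg i

theorem le_M (W : ConvergentApproximation L θ B M x₀ N h v w) {t : ℝ} (ht : 0 ≤ t) (i : ℕ) :
    w t i ≤ M :=
  le_of_tendsto' (W.tendsto t ht i) fun n => (W.approx n).le_M t i

theorem zero (W : ConvergentApproximation L θ B M x₀ N h v w) {t : ℝ} (ht : 0 ≤ t) :
    w t 0 = 0 :=
  tendsto_nhds_unique (W.tendsto t ht 0)
    (tendsto_const_nhds.congr fun n => ((W.approx n).state t).zero.symm)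

theorem mass (W : ConvergentApproximation L θ B M x₀ N h v w) {t : ℝ} (ht : 0 ≤ t) (k : ℕ) :
    ∑ i ∈ Finset.range k, w t i ≤ M := by
  refine le_of_tendsto (tendsto_finsetSum _ fun i _ => W.tendsto t ht i) ?_
  filter_upwards [W.truncation.eventually_ge_atTop k] with n hn
  refine (Finset.sum_le_sum_of_subset_of_nonneg (Finset.range_subset_range.mpr (by omega))
    fun i _ _ => ((W.approx n).state t).nonneg i).trans ((W.approx n).mass t)

theorem moment (W : ConvergentApproximation L θ B M x₀ N h v w) (hB : 0 < B) {t : ℝ}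
    (ht : 0 < t) (k : ℕ) : t * (B * ∑ i ∈ Finset.range k, (i : ℝ) * w t i) ^ 2 ≤ 2 * M := by
  have h1 : Tendsto (fun n => (t - h n) * (B * ∑ i ∈ Finset.range k, (i : ℝ) * v n t i) ^ 2) atTop
      (𝓝 ((t - 0) * (B * ∑ i ∈ Finset.range k, (i : ℝ) * w t i) ^ 2)) :=
    (tendsto_const_nhds.sub W.step).mul (((tendsto_finsetSum _ fun i _ =>
      (W.tendsto t ht.le i).const_mul _).const_mul B).pow 2)
  rw [sub_zero] at h1
  refine le_of_tendsto h1 ?_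
  filter_upwards [W.truncation.eventually_ge_atTop k, W.step.eventually_lt_const ht] with n hn hhn
  refine le_trans (mul_le_mul_of_nonneg_left ?_ (by linarith)) ((W.approx n).moment t ht.le)
  have hnn : ∀ i : ℕ, 0 ≤ (i : ℝ) * v n t i := fun i =>
    mul_nonneg (Nat.cast_nonneg i) (((W.approx n).state t).nonneg i)
  refine pow_le_pow_left₀ (mul_nonneg hB.le (Finset.sum_nonneg fun i _ => hnn i))
    (mul_le_mul_of_nonneg_left ?_ hB.le) 2
  exact Finset.sum_le_sum_of_subset_of_nonneg (Finset.range_subset_range.mpr (by omega))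
    fun i _ _ => hnn i

/-- Passage to the limit in integrals of continuous functions of the state. -/
theorem tendsto_integral (W : ConvergentApproximation L θ B M x₀ N h v w) {t : ℝ} (ht : 0 ≤ t)
    {F : (ℕ → ℝ) → ℝ} (hF : Continuous F) :
    IntervalIntegrable (fun s => F (w s)) volume 0 t ∧
      Tendsto (fun n => ∫ s in (0 : ℝ)..t, F (v n s)) atTop (𝓝 (∫ s in (0 : ℝ)..t, F (w s))) := by
  have hK : IsCompact (Set.univ.pi fun _ : ℕ => Set.Icc (0 : ℝ) M) :=
    isCompact_univ_pi fun _ => isCompact_Icc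
  -- All states lie in the compact cube `[0, M]^ℕ`, so continuity in the product topology supplies
  -- the dominating constant.
  obtain ⟨R, hR⟩ := hK.exists_bound_of_continuousOn hF.continuousOn
  have hpos : ∀ s ∈ Set.uIoc 0 t, 0 ≤ s := fun s hs => by
    rw [Set.uIoc_of_le ht] at hs; exact hs.1.le
  have hlim : ∀ s ∈ Set.uIoc 0 t, Tendsto (fun n => F (v n s)) atTop (𝓝 (F (w s))) := fun s hs =>
    (hF.tendsto _).comp (tendsto_pi_nhds.mpr (W.tendsto s (hpos s hs)))
  have hmeas : ∀ n, AEStronglyMeasurable (fun s => F (v n s)) (volume.restrict (Set.uIoc 0 t)) :=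
    fun n => (intervalIntegrable_iff.mp ((W.approx n).integrable F 0 t)).1
  constructor
  · rw [intervalIntegrable_iff]
    have : IsFiniteMeasure (volume.restrict (Set.uIoc 0 t)) := by
      rw [Set.uIoc]; infer_instance
    refine Integrable.of_bound (aestronglyMeasurable_of_tendsto_ae atTop hmeas
        ((ae_restrict_iff' measurableSet_uIoc).mpr (Eventually.of_forall hlim))) R
      ((ae_restrict_iff' measurableSet_uIoc).mpr (Eventually.of_forall fun s hs => ?_))
    exact hR _ fun i _ => ⟨W.nonneg (hpos s hs) i, W.le_M (hpos s hs) i⟩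
  · refine intervalIntegral.tendsto_integral_filter_of_dominated_convergence (fun _ => R)
      (Eventually.of_forall hmeas)
      (Eventually.of_forall fun n => Eventually.of_forall fun s _ => ?_) (by simp)
      (Eventually.of_forall hlim)
    exact hR _ fun i _ => ⟨((W.approx n).state s).nonneg i, (W.approx n).le_M s i⟩

theorem exists_tail_le (W : ConvergentApproximation L θ B M x₀ N h v w)
    (H : ProductBounds L θ C B) (hx₀ : ∀ i, 0 ≤ x₀ i)
    (hs : Summable x₀) {t η : ℝ} (ht : 0 ≤ t) (hη : 0 < η) :
    ∃ m : ℕ, ∀ k, ∑ j ∈ Finset.Icc m k, ∫ s in (0 : ℝ)..t, θ j * w s j ≤ η := by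
  obtain ⟨m, hm⟩ := SafronovDubovskii.exists_tail_le (L := L) (θ := θ) (B := B) (M := M)
    hx₀ hs ht hη
  refine ⟨m, fun k => ?_⟩
  refine le_of_tendsto (tendsto_finsetSum _ fun j _ =>
    (W.tendsto_integral ht (F := fun x => θ j * x j) (by fun_prop)).2) ?_
  filter_upwards [W.truncation.eventually_ge_atTop k] with n hn
  refine le_trans ?_ (hm _ _ _ (W.approx n))
  rw [← intervalIntegral.integral_finsetSum fun j _ =>
    (W.approx n).integrable (fun x => θ j * x j) 0 t]
  refine intervalIntegral.integral_mono_on ht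
    ((W.approx n).integrable (fun x => ∑ j ∈ Finset.Icc m k, θ j * x j) 0 t)
    ((W.approx n).integrable (fun x => ∑ j ∈ Finset.Icc m (N n), θ j * x j) 0 t) fun s _ => ?_
  exact Finset.sum_le_sum_of_subset_of_nonneg (Finset.Icc_subset_Icc le_rfl hn)
    fun j _ _ => mul_nonneg (H.theta_nonneg j) (((W.approx n).state s).nonneg j)

theorem integral_nonneg (W : ConvergentApproximation L θ B M x₀ N h v w)
    (H : ProductBounds L θ C B) {t : ℝ} (ht : 0 ≤ t) (j : ℕ) :
    0 ≤ ∫ s in (0 : ℝ)..t, θ j * w s j :=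
  intervalIntegral.integral_nonneg ht fun _ hs => mul_nonneg (H.theta_nonneg j) (W.nonneg hs.1 j)

theorem summable_integral (W : ConvergentApproximation L θ B M x₀ N h v w)
    (H : ProductBounds L θ C B) (hx₀ : ∀ i, 0 ≤ x₀ i) (hs : Summable x₀) {t : ℝ} (ht : 0 ≤ t) :
    Summable fun j => ∫ s in (0 : ℝ)..t, θ j * w s j := by
  obtain ⟨m, hm⟩ := W.exists_tail_le H hx₀ hs ht one_pos
  refine summable_of_sum_range_le (W.integral_nonneg H ht)
    (c := ∑ j ∈ Finset.range m, (∫ s in (0 : ℝ)..t, θ j * w s j) + 1) fun k => ?_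
  refine (Finset.sum_le_sum_of_subset_of_nonneg (t := Finset.range m ∪ Finset.Icc m k) ?_
    fun j _ _ => W.integral_nonneg H ht j).trans ?_
  · intro j; simp only [Finset.mem_range, Finset.mem_union, Finset.mem_Icc]; omega
  · rw [Finset.sum_union]
    · linarith [hm k]
    · rw [Finset.disjoint_left]; intro j; simp only [Finset.mem_range, Finset.mem_Icc]; omega

theorem integral_kernel_le (W : ConvergentApproximation L θ B M x₀ N h v w)
    (H : ProductBounds L θ C B) {t : ℝ} (ht : 0 ≤ t) (i j : ℕ) :
    ∫ s in (0 : ℝ)..t, L i j * w s j ≤ C * θ i * ∫ s in (0 : ℝ)..t, θ j * w s j := by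
  rw [← intervalIntegral.integral_const_mul]
  refine intervalIntegral.integral_mono_on ht
    (W.tendsto_integral ht (F := fun x => L i j * x j) (by fun_prop)).1
    (W.tendsto_integral ht (F := fun x => C * θ i * (θ j * x j)) (by fun_prop)).1 fun s hs => ?_
  have := mul_le_mul_of_nonneg_right (H.kernel_le i j) (W.nonneg hs.1 j)
  linarith

theorem summable_integral_kernel (W : ConvergentApproximation L θ B M x₀ N h v w)
    (H : ProductBounds L θ C B) (hx₀ : ∀ i, 0 ≤ x₀ i) (hs : Summable x₀) {t : ℝ} (ht : 0 ≤ t)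
    (i : ℕ) : Summable fun j => ∫ s in (0 : ℝ)..t, L i j * w s j :=
  Summable.of_nonneg_of_le (fun j => intervalIntegral.integral_nonneg ht fun _ hs =>
    mul_nonneg (H.nonneg i j) (W.nonneg hs.1 j)) (W.integral_kernel_le H ht i)
    ((W.summable_integral H hx₀ hs ht).mul_left _)

theorem ae_summable_and_integrable (W : ConvergentApproximation L θ B M x₀ N h v w)
    (H : ProductBounds L θ C B) (hx₀ : ∀ i, 0 ≤ x₀ i) (hs : Summable x₀) {t : ℝ} (ht : 0 ≤ t)
    (i : ℕ) : (∀ᵐ s ∂(volume.restrict (Set.Ioc 0 t)), Summable fun j => L i j * w s j) ∧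
      IntegrableOn (fun s => ∑' j, L i j * w s j) (Set.Ioc 0 t) volume := by
  refine ae_summable_and_integrable_tsum (fun j => ?_) (fun j => ?_) ?_
  · exact (ae_restrict_iff' measurableSet_Ioc).mpr (Eventually.of_forall fun s hs =>
      mul_nonneg (H.nonneg i j) (W.nonneg hs.1.le j))
  · exact (intervalIntegrable_iff_integrableOn_Ioc_of_le ht).mp
      (W.tendsto_integral ht (F := fun x => L i j * x j) (by fun_prop)).1
  · simpa only [intervalIntegral.integral_of_le ht] using W.summable_integral_kernel H hx₀ hs ht i

theorem continuous_flux (i : ℕ) : Continuous fun x => flux L x i := by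
  unfold flux; fun_prop

theorem integral_loss_le (W : ConvergentApproximation L θ B M x₀ N h v w)
    (H : ProductBounds L θ C B) {t : ℝ} (ht : 0 ≤ t) (n i j : ℕ) :
    ∫ s in (0 : ℝ)..t, L i j * v n s i * v n s j ≤
      M * C * θ i * ∫ s in (0 : ℝ)..t, θ j * v n s j := by
  rw [← intervalIntegral.integral_const_mul]
  refine intervalIntegral.integral_mono_on ht
    ((W.approx n).integrable (fun x => L i j * x i * x j) 0 t)
    ((W.approx n).integrable (fun x => M * C * θ i * (θ j * x j)) 0 t) fun s _ => ?_
  have hv := ((W.approx n).state s).nonneg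
  have h1 := mul_le_mul (H.kernel_le i j) ((W.approx n).le_M s i) (hv i)
    (mul_nonneg H.C_nonneg (mul_nonneg (H.theta_nonneg i) (H.theta_nonneg j)))
  have h2 := mul_le_mul_of_nonneg_right h1 (hv j)
  linarith

/-- The infinite loss is not covered by `tendsto_integral`, but each summand is a continuous
function of the state. The uniform `θ`-tails, multiplied by `M * C * θ i` with `i` fixed, allow the
sum and the limit to be exchanged. -/
theorem tendsto_integral_loss (W : ConvergentApproximation L θ B M x₀ N h v w)
    (H : ProductBounds L θ C B) (hM : 0 ≤ M) (hx₀ : ∀ i, 0 ≤ x₀ i) (hs : Summable x₀) {t : ℝ}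
    (ht : 0 ≤ t) (i : ℕ) :
    Tendsto (fun n => ∫ s in (0 : ℝ)..t, ∑ j ∈ Finset.Icc i (N n), L i j * v n s i * v n s j) atTop
      (𝓝 (∫ s in (0 : ℝ)..t, ∑' j, if i ≤ j then L i j * w s i * w s j else 0)) ∧
    IntervalIntegrable (fun s => ∑' j, if i ≤ j then L i j * w s i * w s j else 0)
      volume 0 t := by
  have hcont : ∀ j, Continuous fun x : ℕ → ℝ => if i ≤ j then L i j * x i * x j else 0 := by
    intro j; split_ifs <;> fun_prop
  set b : ℕ → ℕ → ℝ := fun n j => ∫ s in (0 : ℝ)..t, if i ≤ j then L i j * v n s i * v n s j else 0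
    with hb
  set c : ℕ → ℝ := fun j => ∫ s in (0 : ℝ)..t, if i ≤ j then L i j * w s i * w s j else 0 with hc
  have hbc : ∀ j, Tendsto (fun n => b n j) atTop (𝓝 (c j)) := fun j =>
    (W.tendsto_integral ht (hcont j)).2
  have hb0 : ∀ n j, 0 ≤ b n j := fun n j => intervalIntegral.integral_nonneg ht fun s _ => by
    have hv := ((W.approx n).state s).nonneg
    split_ifs
    exacts [mul_nonneg (mul_nonneg (H.nonneg i j) (hv i)) (hv j), le_rfl]
  have hw0 : ∀ s, 0 ≤ s → ∀ j, 0 ≤ if i ≤ j then L i j * w s i * w s j else 0 := fun s hs j => by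
    split_ifs
    exacts [mul_nonneg (mul_nonneg (H.nonneg i j) (W.nonneg hs i)) (W.nonneg hs j), le_rfl]
  have hc0 : ∀ j, 0 ≤ c j := fun j =>
    intervalIntegral.integral_nonneg ht fun s hs => hw0 s hs.1 j
  have hcs : Summable c := by
    refine Summable.of_nonneg_of_le hc0 (fun j => ?_)
      ((W.summable_integral_kernel H hx₀ hs ht i).mul_left M)
    rw [← intervalIntegral.integral_const_mul]
    refine intervalIntegral.integral_mono_on ht (W.tendsto_integral ht (hcont j)).1
      (W.tendsto_integral ht (F := fun x => M * (L i j * x j)) (by fun_prop)).1 fun s hs => ?_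
    have h1 := mul_nonneg (H.nonneg i j) (W.nonneg hs.1 j)
    have h2 := mul_le_mul_of_nonneg_right (W.le_M hs.1 i) h1
    split_ifs
    · linarith
    · exact mul_nonneg hM h1
  have htail : ∀ η > 0, ∃ m, ∀ n, ∑ j ∈ Finset.Icc m (N n), b n j ≤ η := by
    intro η hη
    have hE : 0 ≤ M * C * θ i := mul_nonneg (mul_nonneg hM H.C_nonneg) (H.theta_nonneg i)
    obtain ⟨m, hm⟩ := SafronovDubovskii.exists_tail_le (L := L) (θ := θ) (B := B) (M := M)
      hx₀ hs ht (div_pos hη (by linarith : 0 < M * C * θ i + 1))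
    refine ⟨m, fun n => ?_⟩
    have h1 := hm _ _ _ (W.approx n)
    rw [intervalIntegral.integral_finsetSum fun j _ =>
      (W.approx n).integrable (fun x => θ j * x j) 0 t] at h1
    have hθv : ∀ j, 0 ≤ ∫ s in (0 : ℝ)..t, θ j * v n s j := fun j =>
      intervalIntegral.integral_nonneg ht fun s _ =>
        mul_nonneg (H.theta_nonneg j) (((W.approx n).state s).nonneg j)
    calc ∑ j ∈ Finset.Icc m (N n), b n j
        ≤ ∑ j ∈ Finset.Icc m (N n), M * C * θ i * ∫ s in (0 : ℝ)..t, θ j * v n s j := by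
          refine Finset.sum_le_sum fun j _ => ?_
          simp only [hb]
          split_ifs
          · exact W.integral_loss_le H ht n i j
          · rw [intervalIntegral.integral_zero]; exact mul_nonneg hE (hθv j)
      _ = M * C * θ i * ∑ j ∈ Finset.Icc m (N n), ∫ s in (0 : ℝ)..t, θ j * v n s j := by
          rw [Finset.mul_sum]
      _ ≤ (M * C * θ i + 1) * (η / (M * C * θ i + 1)) := by
          refine mul_le_mul (by linarith) h1 (Finset.sum_nonneg fun j _ => hθv j) (by linarith)
      _ = η := mul_div_cancel₀ _ (by linarith)
  have hFint : ∀ j, IntegrableOn (fun s => if i ≤ j then L i j * w s i * w s j else 0)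
      (Set.Ioc 0 t) volume := fun j =>
    (intervalIntegrable_iff_integrableOn_Ioc_of_le ht).mp (W.tendsto_integral ht (hcont j)).1
  have hF0 : ∀ j, ∀ᵐ s ∂(volume.restrict (Set.Ioc 0 t)),
      0 ≤ if i ≤ j then L i j * w s i * w s j else 0 := fun j =>
    (ae_restrict_iff' measurableSet_Ioc).mpr (Eventually.of_forall fun s hs => hw0 s hs.1.le j)
  have hcs' : Summable fun j =>
      ∫ s in Set.Ioc 0 t, if i ≤ j then L i j * w s i * w s j else 0 := by
    simpa only [hc, intervalIntegral.integral_of_le ht] using hcs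
  refine ⟨?_, (intervalIntegrable_iff_integrableOn_Ioc_of_le ht).mpr
    (ae_summable_and_integrable_tsum hF0 hFint hcs').2⟩
  have hlim := tendsto_sum_of_uniform_tail W.truncation hbc hb0 htail hcs
  have hsum : ∑' j, c j =
      ∫ s in (0 : ℝ)..t, ∑' j, if i ≤ j then L i j * w s i * w s j else 0 := by
    simp only [hc, intervalIntegral.integral_of_le ht]
    refine integral_tsum_of_summable_integral_norm hFint (hcs'.congr fun j => ?_)
    refine integral_congr_ae ?_
    filter_upwards [hF0 j] with s hs0
    rw [Real.norm_eq_abs, abs_of_nonneg hs0]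
  rw [← hsum]
  refine hlim.congr fun n => ?_
  simp only [hb]
  rw [← intervalIntegral.integral_finsetSum fun j _ =>
    (W.approx n).integrable (fun x => if i ≤ j then L i j * x i * x j else 0) 0 t]
  refine intervalIntegral.integral_congr fun s _ => ?_
  rw [← Finset.sum_filter]
  refine Finset.sum_congr ?_ fun _ _ => rfl
  ext j; simp only [Finset.mem_range, Finset.mem_Icc, Finset.mem_filter]; omega

theorem eq_integral (W : ConvergentApproximation L θ B M x₀ N h v w)
    (H : ProductBounds L θ C B) (hM : 0 ≤ M) (hx₀ : ∀ i, 0 ≤ x₀ i) (hs : Summable x₀) {t : ℝ}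
    (ht : 0 ≤ t) (i : ℕ) :
    w t (i + 1) = x₀ (i + 1) + ∫ s in (0 : ℝ)..t, (flux L (w s) i - flux L (w s) (i + 1)
      - ∑' j, if i + 1 ≤ j then L (i + 1) j * w s (i + 1) * w s j else 0) := by
  obtain ⟨hl1, hl2⟩ := W.tendsto_integral_loss H hM hx₀ hs ht (i + 1)
  obtain ⟨f1, f2⟩ := W.tendsto_integral ht (continuous_flux (L := L) i)
  obtain ⟨g1, g2⟩ := W.tendsto_integral ht (continuous_flux (L := L) (i + 1))
  rw [intervalIntegral.integral_sub (f1.sub g1) hl2, intervalIntegral.integral_sub f1 g1]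
  -- The Euler identity stops at the last grid point before `t`; equi-integrability makes the
  -- missing piece, of length at most `h n`, negligible.
  have hrem : Tendsto (fun n => ∫ s in (h n * ⌊t / h n⌋₊)..t, truncField L (N n) (v n s) (i + 1))
      atTop (𝓝 0) := by
    rw [Metric.tendsto_nhds]
    intro ε hε
    obtain ⟨δ, hδ, hmod⟩ := exists_modulus H hM hx₀ hs (i + 1) (half_pos hε)
    filter_upwards [W.step.eventually_lt_const hδ] with n hn
    rw [Real.dist_eq, sub_zero]
    have hh := (W.approx n).step_pos
    have h1 := (Nat.lt_floor_add_one (t / h n)).le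
    rw [div_le_iff₀ hh] at h1
    have h2 := Nat.floor_le (div_nonneg ht hh.le)
    rw [le_div_iff₀ hh] at h2
    exact (hmod _ _ _ (W.approx n) _ _ (by positivity) (by linarith) (by linarith)).trans_lt
      (half_lt_self hε)
  refine tendsto_nhds_unique (W.tendsto t ht (i + 1)) ?_
  have hlim := (((f2.sub g2).sub hl1).sub hrem).const_add (x₀ (i + 1))
  rw [sub_zero] at hlim
  refine hlim.congr' ?_
  filter_upwards [W.truncation.eventually_ge_atTop (i + 1)] with n hn
  have V := W.approx n
  rw [V.eq_integral t ht (i + 1) (by omega) hn]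
  congr 1
  have e1 : ∫ s in (0 : ℝ)..t, truncField L (N n) (v n s) (i + 1) =
      (∫ s in (0 : ℝ)..t, flux L (v n s) i) - (∫ s in (0 : ℝ)..t, flux L (v n s) (i + 1)) -
      ∫ s in (0 : ℝ)..t,
        ∑ j ∈ Finset.Icc (i + 1) (N n), L (i + 1) j * v n s (i + 1) * v n s j := by
    rw [← intervalIntegral.integral_sub (V.integrable (fun x => flux L x i) 0 t)
        (V.integrable (fun x => flux L x (i + 1)) 0 t),
      ← intervalIntegral.integral_sub
        (V.integrable (fun x => flux L x i - flux L x (i + 1)) 0 t)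
        (V.integrable (fun x => ∑ j ∈ Finset.Icc (i + 1) (N n), L (i + 1) j * x (i + 1) * x j) 0 t)]
    simp only [truncField, if_pos hn]
  rw [← e1, ← intervalIntegral.integral_add_adjacent_intervals
    (V.integrable (fun x => truncField L (N n) x (i + 1)) 0 (h n * ⌊t / h n⌋₊))
    (V.integrable (fun x => truncField L (N n) x (i + 1)) (h n * ⌊t / h n⌋₊) t)]
  ring

theorem continuousOn (W : ConvergentApproximation L θ B M x₀ N h v w)
    (H : ProductBounds L θ C B) (hM : 0 ≤ M) (hx₀ : ∀ i, 0 ≤ x₀ i) (hs : Summable x₀) (i : ℕ) :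
    ContinuousOn (fun t => w t i) (Set.Ici 0) := by
  cases i with
  | zero => exact continuousOn_const.congr fun t ht => W.zero ht
  | succ i =>
    refine ContinuousOn.congr (f := fun t => x₀ (i + 1) + ∫ s in (0 : ℝ)..t,
      (flux L (w s) i - flux L (w s) (i + 1)
        - ∑' j, if i + 1 ≤ j then L (i + 1) j * w s (i + 1) * w s j else 0)) ?_
      fun t ht => W.eq_integral H hM hx₀ hs ht i
    refine continuousOn_const.add fun t (ht : 0 ≤ t) => ?_
    -- Working on `[0, t + 1]` makes the interval a neighbourhood of `t` within `[0, ∞)`.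
    have ht1 : 0 ≤ t + 1 := by linarith
    have hint := ((W.tendsto_integral ht1 (continuous_flux (L := L) i)).1.sub
      (W.tendsto_integral ht1 (continuous_flux (L := L) (i + 1))).1).sub
      (W.tendsto_integral_loss H hM hx₀ hs ht1 (i + 1)).2
    have hc := intervalIntegral.continuousOn_primitive_interval' hint Set.left_mem_uIcc
    rw [Set.uIcc_of_le ht1] at hc
    refine (hc t ⟨ht, by linarith⟩).mono_of_mem_nhdsWithin ?_
    exact mem_nhdsWithin.mpr ⟨Set.Iio (t + 1), isOpen_Iio, by simp, fun s hs =>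
      ⟨hs.2, (le_of_lt hs.1)⟩⟩

end ConvergentApproximation


/-! ### Conclusion and transfer to positive indices -/

/-- Existence for the limit system indexed by `ℕ`. -/
theorem exists_convergentApproximation {L : ℕ → ℕ → ℝ} {θ : ℕ → ℝ} {C B : ℝ}
    (H : ProductBounds L θ C B) {x₀ : ℕ → ℝ} (hx₀ : ∀ i, 0 ≤ x₀ i) (hs : Summable x₀) :
    ∃ N h v w, ConvergentApproximation L θ B (∑' i, x₀ i) x₀ N h v w := by
  choose h hh v V using fun n => exists_isApproximation H hx₀ n
    (hs.sum_le_tsum (Finset.range (n + 1)) fun i _ => hx₀ i)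
  have hh0 : Tendsto h atTop (𝓝 0) :=
    squeeze_zero (fun n => (V n).step_pos.le) hh tendsto_one_div_add_atTop_nhds_zero_nat
  obtain ⟨φ, hφ, w, hw⟩ := exists_subseq_tendsto H (tsum_nonneg hx₀) hx₀ hs hh0 V
  exact ⟨φ, h ∘ φ, fun n => v (φ n), w, fun n => V (φ n), hφ.tendsto_atTop,
    hh0.comp hφ.tendsto_atTop, hw⟩

theorem sum_pnat_Ico_one (f : ℕ → ℝ) (hf : f 0 = 0) (i : ℕ+) :
    ∑ j ∈ Finset.Ico 1 i, f j = ∑ j ∈ Finset.range i, f j := by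
  rw [Finset.range_eq_Ico, Finset.sum_eq_sum_Ico_succ_bot i.pos, hf, zero_add, zero_add]
  refine Finset.sum_nbij (fun j : ℕ+ => (j : ℕ)) (fun j hj => ?_) PNat.coe_injective.injOn
    (fun j hj => ?_) fun j _ => rfl
  · simp only [Finset.mem_Ico, ← PNat.coe_le_coe, ← PNat.coe_lt_coe, PNat.one_coe] at hj ⊢
    exact hj
  · simp only [Finset.coe_Ico, Set.mem_Ico] at hj
    refine ⟨⟨j, hj.1⟩, ?_, rfl⟩
    rw [Finset.coe_Ico]
    exact hj

theorem sum_pnat_Icc_one (f : ℕ → ℝ) (hf : f 0 = 0) (i : ℕ+) :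
    ∑ j ∈ Finset.Icc 1 i, f j = ∑ j ∈ Finset.range (i + 1), f j := by
  rw [show (i : ℕ) + 1 = ((i + 1 : ℕ+) : ℕ) from rfl, ← sum_pnat_Ico_one f hf]
  refine Finset.sum_congr (Finset.ext fun j => ?_) fun _ _ => rfl
  simp only [Finset.mem_Icc, Finset.mem_Ico, PNat.lt_add_one_iff]

/-- Extension to `ℕ` of a kernel on `ℕ+`. -/
def natKernel (K : ℕ+ → ℕ+ → ℝ) (i j : ℕ) : ℝ := K i.toPNat' j.toPNat'

theorem natKernel_coe (K : ℕ+ → ℕ+ → ℝ) (i j : ℕ+) : natKernel K i j = K i j := by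
  simp [natKernel]

/-- Index `0` never contributes: it has weight zero in the fluxes and lies below the loss sum. The
values of `natKernel K` there are thus immaterial. -/
theorem rhs_eq (K : ℕ+ → ℕ+ → ℝ) (x : ℕ → ℝ) (i : ℕ+) (k : ℕ) (hik : (i : ℕ) = k + 1) :
    rhs K (fun j => x j) i = flux (natKernel K) x k - flux (natKernel K) x (k + 1)
      - ∑' j, if k + 1 ≤ j then natKernel K (k + 1) j * x (k + 1) * x j else 0 := by
  unfold rhs
  congr 1
  · congr 1
    · rcases Nat.eq_zero_or_pos k with rfl | hk
      · have : i = 1 := PNat.coe_injective (by simpa using hik)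
        subst this
        simp [flux]
      · have hi1 : ((i - 1 : ℕ+) : ℕ) = k := by
          rw [PNat.sub_coe, if_pos (by rw [← PNat.coe_lt_coe, hik, PNat.one_coe]; omega), hik]
          simp
        simp only [← natKernel_coe K, hi1]
        rw [sum_pnat_Ico_one (fun j => (j : ℝ) * natKernel K k j * x j) (by simp), hik, flux]
    · simp only [← natKernel_coe K, hik]
      rw [sum_pnat_Icc_one (fun j => (j : ℝ) * natKernel K (k + 1) j * x j) (by simp), hik, flux]
  · simp only [← natKernel_coe K, hik]
    rw [tsum_subtype (Set.Ici i) fun j : ℕ+ => natKernel K (k + 1) j * x (k + 1) * x j,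
      ← PNat.coe_injective.tsum_eq
        (f := fun j : ℕ => if k + 1 ≤ j then natKernel K (k + 1) j * x (k + 1) * x j else 0)]
    · refine tsum_congr fun j => ?_
      simp only [Set.indicator_apply, Set.mem_Ici, ← PNat.coe_le_coe, hik]
    · intro j hj
      have hj' : k + 1 ≤ j := by
        by_contra hlt
        exact hj (if_neg hlt)
      exact ⟨⟨j, by omega⟩, rfl⟩

/-- `toPNat'` sends `0` to `1`, so the kernel bounds at index `0` are instances of those on `ℕ+`. -/
theorem CoagRateLinear.productBounds {K : ℕ+ → ℕ+ → ℝ} (hK : IsCoagulationKernel K) {θ : ℕ+ → ℝ}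
    {κ : ℕ+ → ℕ+ → ℝ} {A B : ℝ} (hrate : CoagRate K θ κ) (hlin : CoagRateLinear θ κ A B) :
    ProductBounds (natKernel K) (fun i => θ i.toPNat') (1 + A) B where
  symm i j := hK.2 _ _
  theta_nonneg i := hrate.1 _
  le_kernel i j := by
    rw [natKernel, hrate.2.2]; exact le_add_of_nonneg_right (hrate.2.1 _ _)
  kernel_le i j := by
    rw [natKernel, hrate.2.2]; linarith [hlin.2.2.2 i.toPNat' j.toPNat']
  C_nonneg := by linarith [hlin.2.2.1]
  B_pos := hlin.1
  linear i := by
    rcases Nat.eq_zero_or_pos i with rfl | hi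
    · simpa using hrate.1 _
    · have h1 := hlin.2.1.1 (Set.mem_range_self i.toPNat')
      have h2 : ((i.toPNat' : ℕ+) : ℕ) = i := Nat.toPNat'_coe i ▸ if_pos hi
      simp only [h2] at h1
      rwa [le_div_iff₀ (by exact_mod_cast hi)] at h1

theorem summable_of_mem_Y_zero {y : ℕ+ → ℝ} (hy : y ∈ Y 0) : Summable fun i => |y i| := by
  have h : ∑' i : ℕ+, ENNReal.ofReal (((i : ℕ) : ℝ) ^ (0 : ℝ) * |y i|) ≠ ∞ := ne_of_lt hy
  refine (ENNReal.summable_toReal h).congr fun i => ?_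
  rw [Real.rpow_zero, one_mul, ENNReal.toReal_ofReal (abs_nonneg _)]

end SafronovDubovskii

open SafronovDubovskii in
theorem mainTheorem2
    (K : ℕ+ → ℕ+ → ℝ) (hK : SafronovDubovskii.IsCoagulationKernel K)
    (θ : ℕ+ → ℝ) (κ : ℕ+ → ℕ+ → ℝ) (A B : ℝ)
    (hrate : SafronovDubovskii.CoagRate K θ κ)
    (hlin : SafronovDubovskii.CoagRateLinear θ κ A B)
    (ω₀ : ℕ+ → ℝ) (hω₀ : ω₀ ∈ SafronovDubovskii.YPos 0) :
    ∃ ω : ℕ+ → ℝ → ℝ,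
      SafronovDubovskii.IsSolution K ω₀ ⊤ ω ∧
      (∀ t : ℝ, 0 ≤ t → (fun i => ω i t) ∈ SafronovDubovskii.YPos 0) ∧
      (∀ t : ℝ, 0 < t → SafronovDubovskii.normY 1 (fun i => ω i t) < ∞) := by
  have H := CoagRateLinear.productBounds hK hrate hlin
  set x₀ : ℕ → ℝ := fun i => if i = 0 then 0 else ω₀ i.toPNat' with hx₀def
  have hxω : ∀ i : ℕ+, x₀ i = ω₀ i := fun i => by simp [hx₀def]
  have hx₀ : ∀ i, 0 ≤ x₀ i := fun i => by
    simp only [hx₀def]; split_ifs; exacts [le_rfl, hω₀.2 _]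
  have hs : Summable x₀ := by
    rw [← PNat.coe_injective.summable_iff]
    · refine (summable_of_mem_Y_zero hω₀.1).congr fun i => ?_
      rw [abs_of_nonneg (hω₀.2 i), Function.comp, hxω]
    · intro i hi
      rcases Nat.eq_zero_or_pos i with rfl | hpos
      · rfl
      · exact absurd ⟨⟨i, hpos⟩, rfl⟩ hi
  have hM : 0 ≤ ∑' i, x₀ i := tsum_nonneg hx₀
  obtain ⟨N, h, v, w, W⟩ := exists_convergentApproximation H hx₀ hs
  -- In the full kernel sum index `0` carries no vanishing weight; it drops out because `w s 0 = 0`.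
  have hsupp : ∀ s, 0 ≤ s → ∀ i : ℕ+,
      Function.support (fun j : ℕ => natKernel K i j * w s j) ⊆ Set.range ((↑) : ℕ+ → ℕ) := by
    intro s hs0 i j hj
    rcases Nat.eq_zero_or_pos j with rfl | hpos
    · simp [W.zero hs0] at hj
    · exact ⟨⟨j, hpos⟩, rfl⟩
  refine ⟨fun i t => w t i, ⟨?_, ?_, ?_, ?_, ?_⟩, ?_, ?_⟩
  · exact fun i t ht _ => W.nonneg ht i
  · exact fun i => (W.continuousOn H hM hx₀ hs i).mono fun t ht => ht.1
  · intro i t ht _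
    refine ae_mono (Measure.restrict_mono Set.Ioo_subset_Ioc_self le_rfl)
      ((W.ae_summable_and_integrable H hx₀ hs ht i).1.mono fun s hsum => ?_)
    refine (hsum.comp_injective PNat.coe_injective).congr fun j => ?_
    simp only [Function.comp, natKernel_coe]
  · intro i t ht _
    refine ((W.ae_summable_and_integrable H hx₀ hs ht i).2.mono_set Set.Ioo_subset_Ioc_self).congr_fun
      (fun s hs' => ?_) measurableSet_Ioo
    simp only [← natKernel_coe K]
    exact (PNat.coe_injective.tsum_eq (hsupp s hs'.1.le i)).symm
  · intro i t ht _
    obtain ⟨k, hk⟩ : ∃ k, (i : ℕ) = k + 1 := ⟨i.natPred, (PNat.natPred_add_one i).symm⟩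
    simp only [rhs_eq K _ i k hk]
    rw [← hxω, hk]
    exact W.eq_integral H hM hx₀ hs ht k
  · intro t ht
    refine ⟨?_, fun i => W.nonneg ht i⟩
    have hsum : Summable fun i => w t i :=
      summable_of_sum_range_le (fun i => W.nonneg ht i) (W.mass ht)
    refine lt_of_eq_of_lt ?_ (hsum.comp_injective PNat.coe_injective).tsum_ofReal_lt_top
    refine tsum_congr fun i => ?_
    rw [Real.rpow_zero, one_mul, abs_of_nonneg (W.nonneg ht i), Function.comp]
  · intro t ht
    have hsum : Summable fun i : ℕ => (i : ℝ) * w t i := by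
      refine summable_of_sum_range_le (c := 1 / (4 * (t * B ^ 2)) + 2 * ∑' i, x₀ i)
        (fun i => mul_nonneg (Nat.cast_nonneg i) (W.nonneg ht.le i)) fun k => ?_
      have h1 := W.moment hlin.1 ht k
      -- Young's inequality with `c = t * B ^ 2` matches the bound on the squared moment, so no
      -- square root is needed.
      have h2 := le_add_mul_sq (by have := hlin.1; positivity : 0 < t * B ^ 2)
        (∑ i ∈ Finset.range k, (i : ℝ) * w t i)
      linarith
    refine lt_of_eq_of_lt ?_ (hsum.comp_injective PNat.coe_injective).tsum_ofReal_lt_top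
    refine tsum_congr fun i => ?_
    rw [Real.rpow_one, abs_of_nonneg (W.nonneg ht.le i), Function.comp]
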